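/- Let $(M,g)$ be a smooth Riemannian manifold of dimension $m\ge 1$ (Hausdorff, second countable; completeness is not assumed) with non-empty smooth boundary $\partial M$, and write $\mathrm{int}\,M=M\setminus\partial M$. For an open set $D\subseteq M$, which may contain points of $\partial M$, let $W^{1,2}_{loc}(D)$ be the set of functions $u$ on $D$ with a weak gradient $\nabla u$ such that $u$ and $|\nabla u|$ are square integrable on every compact subset of $D$ (including compact subsets that meet $\partial M$). A function $u\in W^{1,2}_{loc}(D)$ is called a weak Neumann subsolution on $D$ (that is, $\Delta u\ge 0$ on $D$ and $\partial u/\partial\nu\le 0$ on $\partial M\cap D$ in the weak sense) if $$-\int_D\langle\nabla u,\nabla\varphi\rangle\,d\mathrm{vol}_g\ \ge\ 0\qquad\text{for all } 0\le\varphi\in C_c^\infty(D),$$ where the test functions $\varphi$ need not vanish on $\partial M\cap D$. If $D\subseteq \mathrm{int}\,M$, there is no boundary condition, and this is the usual weak form of $\Delta u\ge 0$ on $D$. The manifold $M$ is called parabolic if every weak Neumann subsolution $u\in C^0(M)\cap W^{1,2}_{loc}(M)$ on $D=M$ with $\sup_M u<+\infty$ is constant. **Theorem.** Let $M$ be parabolic.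 If $u\in C^0(M)\cap W^{1,2}_{loc}(\mathrm{int}\,M)$ satisfies $\sup_M u<+\infty$ and $\Delta u\ge 0$ on $\mathrm{int}\,M$ in the weak sense (no condition is imposed on $\partial u/\partial\nu$ along $\partial M$), then $$\sup_M u=\sup_{\partial M}u .$$ -/

import Mathlib

open Set MeasureTheory
open scoped Manifold ContDiff

namespace RiemBdry

noncomputable section

/-- The coordinate space of an `m`-dimensional manifold. -/
abbrev Coord (m : ℕ) : Type := EuclideanSpace ℝ (Fin m)

/-- Smooth Riemannian metrics on a smooth `m`-dimensional manifold `M` with (smooth) boundary: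
`g.inner x v w` is the scalar product of `v, w ∈ T_x M`, symmetric, positive definite and
depending smoothly on `x`, up to the boundary. -/
abbrev Metric (m : ℕ) [NeZero m] (M : Type*) [TopologicalSpace M]
    [ChartedSpace (EuclideanHalfSpace m) M] [IsManifold (𝓡∂ m) ∞ M] :=
  Bundle.ContMDiffRiemannianMetric (𝓡∂ m) ∞ (Coord m)
    (fun x : M => TangentSpace (𝓡∂ m) x)

section Charts

variable {m : ℕ} [NeZero m] {M : Type*} [TopologicalSpace M]
  [ChartedSpace (EuclideanHalfSpace m) M]

/-- The inverse of the chart at `p`, from (a relatively open subset of) the closed half space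
of `ℝ^m` to `M`. -/
def param (p : M) (y : Coord m) : M := (extChartAt (𝓡∂ m) p).symm y

/-- The part of the coordinate domain of the chart at `p` which represents `D ⊆ M`. -/
def chartDomain (p : M) (D : Set M) : Set (Coord m) :=
  (extChartAt (𝓡∂ m) p).target ∩ param p ⁻¹' D

/-- The tangent vector at the point with coordinates `y` in the chart at `p` whose
coordinates are `e`, that is `∑ i, e i • ∂/∂y_i`. -/
def coordVector (p : M) (y : Coord m) (e : Coord m) : TangentSpace (𝓡∂ m) (param p y) :=
  mfderivWithin 𝓘(ℝ, Coord m) (𝓡∂ m) (extChartAt (𝓡∂ m) p).symm (range (𝓡∂ m)) y e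

/-- The derivative `dφ(V) = ⟨V, ∇φ⟩` of the smooth function `φ` in the direction of the vector
field `V`. -/
def dirDeriv (V : (x : M) → TangentSpace (𝓡∂ m) x) (φ : M → ℝ) (x : M) : ℝ :=
  mfderiv (𝓡∂ m) 𝓘(ℝ, ℝ) φ x (V x)

variable [IsManifold (𝓡∂ m) ∞ M]

/-- The coefficients `g_ij = ⟨∂/∂y_i, ∂/∂y_j⟩` of the metric in the chart at `p`. -/
def gramMatrix (g : Metric m M) (p : M) (y : Coord m) : Matrix (Fin m) (Fin m) ℝ :=
  Matrix.of fun i j =>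
    g.inner (param p y) (coordVector p y (EuclideanSpace.single i 1))
      (coordVector p y (EuclideanSpace.single j 1))

/-- The component `⟨V, ∑ i, e i • ∂/∂y_i⟩` of a vector field `V`, as a function of the
coordinates `y` in the chart at `p`. -/
def component (g : Metric m M) (V : (x : M) → TangentSpace (𝓡∂ m) x)
    (p : M) (e : Coord m) (y : Coord m) : ℝ :=
  g.inner (param p y) (V (param p y)) (coordVector p y e)

/-- The Riemannian volume of the domain of the chart at `p`, that is `√(det g_ij) dy` on the
coordinate domain, carried over to `M`. -/
def chartVolume [MeasurableSpace M] (g : Metric m M) (p : M) : Measure M :=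
  ((volume.restrict (extChartAt (𝓡∂ m) p).target).withDensity
    (fun y => ENNReal.ofReal (Real.sqrt (gramMatrix g p y).det))).map (param p)

/-- The Riemannian volume measure. The measures `chartVolume g p` agree on the overlaps of the
charts, hence their least upper bound among the measures on `M` is the measure which restricts
to `chartVolume g p` on the domain of the chart at `p`, for every `p`. -/
def vol [MeasurableSpace M] (g : Metric m M) : Measure M := ⨆ p : M, chartVolume g p

/-- The vector field `V` is the weak gradient of `u` on the open set `D ⊆ M`, and `u` and `V` are
locally square integrable on `D`, up to the points of `D` on the boundary of `M`. In other
words, `u ∈ W^{1,2}_loc(D)` and `∇u = V`. The weak derivatives are those of distribution theory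
in the interior of the coordinate domains: `∫ u ∂_e ψ dy = - ∫ ⟨V, ∂_e⟩ ψ dy`. -/
structure IsWeakGradient (g : Metric m M) (D : Set M) (u : M → ℝ)
    (V : (x : M) → TangentSpace (𝓡∂ m) x) : Prop where
  memLp_fun : ∀ (p : M) (K : Set (Coord m)), IsCompact K → K ⊆ chartDomain p D →
    MemLp (fun y => u (param p y)) 2 (volume.restrict K)
  memLp_grad : ∀ (p : M) (e : Coord m) (K : Set (Coord m)), IsCompact K → K ⊆ chartDomain p D →
    MemLp (component g V p e) 2 (volume.restrict K)
  integral_eq : ∀ (p : M) (e : Coord m) (ψ : Coord m → ℝ), ContDiff ℝ ∞ ψ →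
    HasCompactSupport ψ → tsupport ψ ⊆ interior (chartDomain p D) →
    ∫ y, u (param p y) * fderiv ℝ ψ y e = - ∫ y, component g V p e y * ψ y

/-- `u ∈ W^{1,2}_loc(D)`. -/
def MemW12loc (g : Metric m M) (D : Set M) (u : M → ℝ) : Prop :=
  ∃ V : (x : M) → TangentSpace (𝓡∂ m) x, IsWeakGradient g D u V

/-- `u ∈ W^{1,2}_loc(D)` satisfies `Δu ≥ 0` on the open set `D ⊆ M` and `∂u/∂ν ≤ 0` on `∂M ∩ D`
in the weak Neumann sense: `- ∫_D ⟨∇u, ∇φ⟩ ≥ 0` for all `0 ≤ φ ∈ C_c^∞(D)`. The test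
functions need not vanish on `∂M ∩ D`.
If `D` is contained in the interior of `M`, this is `Δu ≥ 0` on `D` in the weak sense. -/
def IsWeakNeumannSubsolution [MeasurableSpace M] (g : Metric m M) (D : Set M) (u : M → ℝ) :
    Prop :=
  ∃ V : (x : M) → TangentSpace (𝓡∂ m) x, IsWeakGradient g D u V ∧
    ∀ φ : M → ℝ, ContMDiff (𝓡∂ m) 𝓘(ℝ, ℝ) ∞ φ → HasCompactSupport φ → tsupport φ ⊆ D →
      (∀ x, 0 ≤ φ x) →
      0 ≤ - ∫ x in D, dirDeriv V φ x ∂(vol g)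

/-- `M` is (Neumann) parabolic: every bounded above weak Neumann subsolution
`u ∈ C^0(M) ∩ W^{1,2}_loc(M)` of the Laplace equation on `M` is constant. -/
def IsParabolic [MeasurableSpace M] (g : Metric m M) : Prop :=
  ∀ u : M → ℝ, Continuous u → MemW12loc g univ u → IsWeakNeumannSubsolution g univ u →
    BddAbove (range u) → ∃ c : ℝ, ∀ x, u x = c

end Charts

end

end RiemBdry

/-!
Suppose that `sup_M u > sup_∂M u`, and choose a level `c` strictly between the two. Let `f` be a
smooth convex function which vanishes on `(-∞, c]` and is positive and increasing on `(c, ∞)`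
(`convexGlue`). The function `f(u)` vanishes near `∂M`, hence the boundary condition holds for it
trivially, and `Δ f(u) = f'(u) Δu + f''(u) |∇u|² ≥ 0` in the interior, since `f' ≥ 0` and
`f'' ≥ 0`. So `f(u)` is a bounded weak Neumann subsolution on `M`. By parabolicity it is constant,
which is absurd: it is zero on the boundary, and positive where `u > c`.

The smooth function `f` replaces the usual truncation `max u c`. Two facts about weak derivatives
carry the argument, both proved in coordinates by approximating `u`, near a compact set, by
mollifications `u_n`. These converge pointwise and boundedly because `u` is continuous, and
`∇u_n → ∇u` in `L²` (`HasWeakDerivOn.exists_smooth_approx`).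

* The chain rule `∇ f(u) = f'(u) ∇u` (`HasWeakDerivOn.comp`) is the limit of the chain rule for
  `u_n`.
* The inequality for `f(u)` (`HasWeakDerivOn.integral_comp_mul_nonpos`): for a test function
  `η ≥ 0`, the product `f'(u_n) η` is smooth, hence an admissible test function for `u`, and the
  limit of `∫ ⟨∇u, ∇(f'(u_n) η)⟩ ≤ 0` is `∫ f'(u) ⟨∇u, ∇η⟩ ≤ - ∫ f''(u) η |∇u|² ≤ 0`.

To pass from `M` to coordinates one needs that the Riemannian volume is given in every chart by the
density `√(det g_ij)` of that chart (`vol_restrict_source`), which is the change of variables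
formula for the transition maps. A test function on `M` is cut by a partition of unity into pieces
supported in charts (`integral_dirDeriv_comp_smul_nonpos`). Only the part of its support where
`u ≥ c` has to be covered; this part is a compact subset of the interior of `M`, and each of its
points has coordinates in the interior of the half space in its preferred chart.
-/

namespace RiemBdry

open Filter Topology Convolution ENNReal

/-! ### Mollification in `L²` -/

section Mollification

variable {E : Type*} [NormedAddCommGroup E] [NormedSpace ℝ E] [FiniteDimensional ℝ E]
  [MeasurableSpace E] [BorelSpace E] {μ : Measure E} [μ.IsAddHaarMeasure]

/-- Translation is continuous in `L²`. -/
theorem tendsto_eLpNorm_translate_sub {b : E → ℝ} (hb : MemLp b 2 μ) :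
    Tendsto (fun t : E => eLpNorm (fun x => b (x - t) - b x) 2 μ) (𝓝 0) (𝓝 0) := by
  have : Fact ((2 : ℝ≥0∞) ≠ ⊤) := ⟨by simp⟩
  have hc : Continuous fun t : E => DomAddAct.mk (-t) +ᵥ hb.toLp b := by
    have : Continuous fun t : E => DomAddAct.mk (-t) :=
      (DomAddAct.continuous_mk).comp continuous_neg
    exact this.vadd continuous_const
  have h0 := hc.tendsto 0
  rw [tendsto_iff_edist_tendsto_0] at h0
  refine h0.congr fun t => ?_
  rw [DomAddAct.mk_vadd_toLp, DomAddAct.mk_vadd_toLp, Lp.edist_toLp_toLp]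
  congr 1
  ext x
  simp [vadd_eq_add, sub_eq_neg_add]

/-- If every translate of `b` by a vector of length less than `r` is `ε`-close to `b` in `L²`, then
so is the average of those translates which is the mollification of `b` at scale `r`. -/
theorem eLpNorm_mollify_sub_le {b : E → ℝ} (hb : MemLp b 2 μ) (φ : ContDiffBump (0 : E))
    {ε : ℝ≥0∞}
    (hε : ∀ t ∈ Metric.ball (0 : E) φ.rOut, eLpNorm (fun x => b (x - t) - b x) 2 μ ≤ ε) :
    eLpNorm (fun x => (φ.normed μ ⋆[ContinuousLinearMap.lsmul ℝ ℝ, μ] b) x - b x) 2 μ ≤ ε := by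
  set ρ := φ.normed μ with hρ
  have hρ0 : ∀ t, 0 ≤ ρ t := φ.nonneg_normed
  have hρm : Measurable fun t => ENNReal.ofReal (ρ t) :=
    φ.continuous_normed.measurable.ennreal_ofReal
  -- The mollification at `x` is the mean of `b (x - t)` for the probability measure `ν = ρ dμ`.
  set ν := μ.withDensity fun t => ENNReal.ofReal (ρ t) with hν
  have hν1 : IsProbabilityMeasure ν := ⟨by
    rw [hν, withDensity_apply _ MeasurableSet.univ, Measure.restrict_univ,
      ← ofReal_integral_eq_lintegral_ofReal φ.integrable_normed
        (Eventually.of_forall φ.nonneg_normed), φ.integral_normed, ENNReal.ofReal_one]⟩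
  have hνμ : ν ≪ μ := withDensity_absolutelyContinuous _ _
  have hli : LocallyIntegrable b μ := hb.locallyIntegrable (by norm_num)
  have hpair : AEStronglyMeasurable (fun q : E × E => b (q.1 - q.2) - b q.1) (μ.prod ν) :=
    (hb.1.comp_quasiMeasurePreserving
      (quasiMeasurePreserving_sub_of_right_invariant μ ν)).sub hb.1.comp_fst
  have hsec : ∀ x, AEStronglyMeasurable (fun t => b (x - t) - b x) ν := fun x =>
    ((hb.1.comp_quasiMeasurePreserving (quasiMeasurePreserving_sub_left μ x)).sub
      aestronglyMeasurable_const).mono_ac hνμ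
  -- Jensen's inequality for this mean, to be integrated in `x` by Tonelli's theorem.
  have hpt : ∀ x, ‖(ρ ⋆[ContinuousLinearMap.lsmul ℝ ℝ, μ] b) x - b x‖ₑ ^ (2 : ℝ)
      ≤ ∫⁻ t, ‖b (x - t) - b x‖ₑ ^ (2 : ℝ) ∂ν := by
    intro x
    have hce : Integrable (fun t => ρ t • b (x - t)) μ :=
      (φ.hasCompactSupport_normed.convolutionExists_left (ContinuousLinearMap.lsmul ℝ ℝ)
        φ.continuous_normed hli) x
    have h1 : (ρ ⋆[ContinuousLinearMap.lsmul ℝ ℝ, μ] b) x - b x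
        = ∫ t, (b (x - t) - b x) ∂ν := by
      rw [hν, integral_withDensity_eq_integral_toReal_smul hρm
        (Eventually.of_forall fun _ => ENNReal.ofReal_lt_top)]
      simp_rw [ENNReal.toReal_ofReal (hρ0 _), smul_sub]
      rw [integral_sub hce (φ.integrable_normed.smul_const _), φ.integral_normed_smul]
      rfl
    have h2 : ‖∫ t, (b (x - t) - b x) ∂ν‖ₑ ≤ eLpNorm (fun t => b (x - t) - b x) 2 ν := by
      refine (enorm_integral_le_lintegral_enorm _).trans ?_
      rw [← eLpNorm_one_eq_lintegral_enorm]
      exact eLpNorm_le_eLpNorm_of_exponent_le (by norm_num) (hsec x)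
    rw [h1]
    refine (ENNReal.rpow_le_rpow h2 (by norm_num)).trans (le_of_eq ?_)
    exact eLpNorm_nnreal_pow_eq_lintegral (p := 2) (by norm_num)
  have hmain : eLpNorm (fun x => (ρ ⋆[ContinuousLinearMap.lsmul ℝ ℝ, μ] b) x - b x) 2 μ ^ (2 : ℝ)
      ≤ ε ^ (2 : ℝ) := by
    rw [show eLpNorm (fun x => (ρ ⋆[ContinuousLinearMap.lsmul ℝ ℝ, μ] b) x - b x) 2 μ ^ (2 : ℝ)
      = ∫⁻ x, ‖(ρ ⋆[ContinuousLinearMap.lsmul ℝ ℝ, μ] b) x - b x‖ₑ ^ (2 : ℝ) ∂μ from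
        eLpNorm_nnreal_pow_eq_lintegral (p := 2) (by norm_num)]
    calc _ ≤ ∫⁻ x, ∫⁻ t, ‖b (x - t) - b x‖ₑ ^ (2 : ℝ) ∂ν ∂μ := lintegral_mono hpt
      _ = ∫⁻ t, ∫⁻ x, ‖b (x - t) - b x‖ₑ ^ (2 : ℝ) ∂μ ∂ν :=
        lintegral_lintegral_swap (hpair.enorm.pow_const _)
      _ ≤ ∫⁻ _, ε ^ (2 : ℝ) ∂ν := by
        refine lintegral_mono_ae ?_
        have hae : ∀ᵐ t ∂ν, t ∈ Metric.ball (0 : E) φ.rOut := by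
          rw [hν, ae_withDensity_iff hρm]
          refine Eventually.of_forall fun t ht => ?_
          rw [← φ.support_normed_eq (μ := μ)]
          intro h0
          exact ht (by rw [hρ, h0, ENNReal.ofReal_zero])
        filter_upwards [hae] with t ht
        refine (le_of_eq ?_).trans (ENNReal.rpow_le_rpow (hε t ht) (by norm_num))
        exact (eLpNorm_nnreal_pow_eq_lintegral (p := 2) (by norm_num)).symm
      _ = ε ^ (2 : ℝ) := by simp
  exact (ENNReal.rpow_le_rpow_iff (by norm_num)).1 hmain

theorem tendsto_eLpNorm_mollify_sub {b : E → ℝ} (hb : MemLp b 2 μ) {φ : ℕ → ContDiffBump (0 : E)}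
    (hφ : Tendsto (fun n => (φ n).rOut) atTop (𝓝 0)) :
    Tendsto (fun n => eLpNorm
      (fun x => ((φ n).normed μ ⋆[ContinuousLinearMap.lsmul ℝ ℝ, μ] b) x - b x) 2 μ)
      atTop (𝓝 0) := by
  rw [ENNReal.tendsto_nhds_zero]
  intro ε hε
  obtain ⟨r, hr, hball⟩ := Metric.eventually_nhds_iff_ball.1
    (ENNReal.tendsto_nhds_zero.1 (tendsto_eLpNorm_translate_sub hb) ε hε)
  filter_upwards [hφ.eventually (gt_mem_nhds hr)] with n hn
  exact eLpNorm_mollify_sub_le hb (φ n) fun t ht => hball t (Metric.ball_subset_ball hn.le ht)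

end Mollification

/-! ### Smooth approximation of functions with weak derivatives -/

section WeakDerivative

variable {E : Type*} [NormedAddCommGroup E] [NormedSpace ℝ E] [FiniteDimensional ℝ E]
  [MeasurableSpace E] [BorelSpace E] {μ : Measure E} [μ.IsAddHaarMeasure]

/-- On the open set `O`, the functions `b e` are locally square integrable and are the weak
directional derivatives `∂_e U`. Linearity of `b e` in `e` is not part of the definition. -/
structure HasWeakDerivOn (μ : Measure E) (O : Set E) (U : E → ℝ) (b : E → E → ℝ) : Prop where
  memLp : ∀ e K, IsCompact K → K ⊆ O → MemLp (b e) 2 (μ.restrict K)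
  integral_eq : ∀ (e : E) (ψ : E → ℝ), ContDiff ℝ ∞ ψ → HasCompactSupport ψ → tsupport ψ ⊆ O →
    ∫ y, U y * fderiv ℝ ψ y e ∂μ = - ∫ y, b e y * ψ y ∂μ

/-- The derivative of a mollification is the mollification of the weak derivative, at points whose
distance to the complement of `O` is larger than the scale of the mollification. -/
theorem HasWeakDerivOn.fderiv_mollify {O L : Set E} {U : E → ℝ} {b : E → E → ℝ}
    (hb : HasWeakDerivOn μ O U b) (hL : MeasurableSet L) (hLO : L ⊆ O)
    (hUL : IntegrableOn U L μ) (φ : ContDiffBump (0 : E)) (x e : E)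
    (hx : Metric.closedBall x φ.rOut ⊆ L) :
    fderiv ℝ (φ.normed μ ⋆[ContinuousLinearMap.lsmul ℝ ℝ, μ] L.indicator U) x e
      = (φ.normed μ ⋆[ContinuousLinearMap.lsmul ℝ ℝ, μ] L.indicator (b e)) x := by
  set ρ := φ.normed μ with hρ
  have hρs : ContDiff ℝ ∞ ρ := φ.contDiff_normed
  have hρc : HasCompactSupport ρ := φ.hasCompactSupport_normed
  have hUi : LocallyIntegrable (L.indicator U) μ :=
    ((integrable_indicator_iff hL).2 hUL).locallyIntegrable
  have hts : tsupport ρ = Metric.closedBall 0 φ.rOut := φ.tsupport_normed_eq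
  have hout : ∀ t, x - t ∉ L → ρ t = 0 := by
    intro t ht
    by_contra h
    have : t ∈ tsupport ρ := subset_tsupport _ h
    rw [hts] at this
    refine ht (hx ?_)
    rw [Metric.mem_closedBall, dist_eq_norm] at this ⊢
    simpa using this
  have hout' : ∀ t, x - t ∉ L → fderiv ℝ ρ t = 0 := by
    intro t ht
    by_contra h
    have : t ∈ tsupport ρ := support_fderiv_subset ℝ h
    rw [hts] at this
    refine ht (hx ?_)
    rw [Metric.mem_closedBall, dist_eq_norm] at this ⊢
    simpa using this
  -- The mollifier centred at `x`, as a test function.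
  set ψ : E → ℝ := fun y => ρ (x - y) with hψ
  have hψd : ∀ y, fderiv ℝ ψ y e = - fderiv ℝ ρ (x - y) e := by
    intro y
    have h1 : HasFDerivAt (fun y : E => x - y) (-(ContinuousLinearMap.id ℝ E)) y :=
      (hasFDerivAt_id y).const_sub x
    have h2 := ((hρs.differentiable (by simp)) (x - y)).hasFDerivAt.comp y h1
    have h3 : fderiv ℝ ψ y = _ := h2.fderiv
    rw [h3]
    simp
  have hψs : tsupport ψ ⊆ Metric.closedBall x φ.rOut := by
    refine closure_minimal ?_ Metric.isClosed_closedBall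
    intro y hy
    have : x - y ∈ tsupport ρ := subset_tsupport _ hy
    rw [hts] at this
    simpa [Metric.mem_closedBall, dist_eq_norm, norm_sub_rev] using this
  have hψ0 : ∀ y, y ∉ L → ψ y = 0 := fun y hy => hout (x - y) (by simpa using hy)
  have hψd0 : ∀ y, y ∉ L → fderiv ℝ ρ (x - y) e = 0 := fun y hy => by
    rw [hout' (x - y) (by simpa using hy)]; simp
  have hd := hρc.hasFDerivAt_convolution_left (ContinuousLinearMap.lsmul ℝ ℝ)
    (hρs.of_le (by simp)) hUi x
  have hce : Integrable (fun t => (ContinuousLinearMap.lsmul ℝ ℝ).precompL E (fderiv ℝ ρ t)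
      (L.indicator U (x - t))) μ :=
    ((hρc.fderiv ℝ).convolutionExists_left _ (hρs.continuous_fderiv (by simp)) hUi) x
  rw [hd.fderiv, convolution_def, ContinuousLinearMap.integral_apply hce, convolution_def]
  simp only [ContinuousLinearMap.precompL_apply, ContinuousLinearMap.lsmul_apply, smul_eq_mul]
  rw [← integral_sub_left_eq_self (fun t => fderiv ℝ ρ t e * L.indicator U (x - t)) μ x,
    ← integral_sub_left_eq_self (fun t => ρ t * L.indicator (b e) (x - t)) μ x]
  simp only [_root_.sub_sub_cancel]
  have h1 : ∀ y, fderiv ℝ ρ (x - y) e * L.indicator U y = - (U y * fderiv ℝ ψ y e) := by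
    intro y
    by_cases hy : y ∈ L
    · rw [indicator_of_mem hy, hψd]; ring
    · rw [hψd, hψd0 y hy]; ring
  have h2 : ∀ y, ρ (x - y) * L.indicator (b e) y = b e y * ψ y := by
    intro y
    by_cases hy : y ∈ L
    · rw [indicator_of_mem hy]; ring
    · rw [hψ0 y hy, show ρ (x - y) = 0 from hψ0 y hy]; ring
  simp_rw [h1, h2]
  rw [integral_neg, hb.integral_eq e ψ (hρs.comp (contDiff_const.sub contDiff_id))
    (HasCompactSupport.of_support_subset_isCompact (isCompact_closedBall x φ.rOut)
      ((subset_tsupport ψ).trans hψs)) (hψs.trans (hx.trans hLO)), neg_neg]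

/-- Smooth approximation of a continuous function with locally square integrable weak derivatives,
near a given compact set. -/
theorem HasWeakDerivOn.exists_smooth_approx {O K : Set E} (hO : IsOpen O) (hK : IsCompact K)
    (hKO : K ⊆ O) {U : E → ℝ} (hU : ContinuousOn U O) {b : E → E → ℝ}
    (hb : HasWeakDerivOn μ O U b) :
    ∃ (Un : ℕ → E → ℝ) (R : ℝ), (∀ n, ContDiff ℝ ∞ (Un n)) ∧ (∀ n x, |Un n x| ≤ R) ∧
      (∀ x ∈ K, Tendsto (fun n => Un n x) atTop (𝓝 (U x))) ∧
      ∀ e, Tendsto (fun n => eLpNorm (fun x => fderiv ℝ (Un n) x e - b e x) 2 (μ.restrict K))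
        atTop (𝓝 0) := by
  obtain ⟨δ, hδ, hLO⟩ := hK.exists_cthickening_subset_open hO hKO
  set L := Metric.cthickening δ K
  have hL : IsCompact L := hK.cthickening
  have hLm : MeasurableSet L := hL.measurableSet
  have hUL : IntegrableOn U L μ := (hU.mono hLO).integrableOn_compact hL
  obtain ⟨R, hR⟩ := hL.exists_bound_of_continuousOn (hU.mono hLO)
  have hR' : ∀ x, |L.indicator U x| ≤ max R 0 := by
    intro x
    by_cases hx : x ∈ L
    · rw [indicator_of_mem hx]; exact (hR x hx).trans (le_max_left _ _)
    · rw [indicator_of_notMem hx]; simp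
  -- The scale of the `n`-th mollification is `δ / (n + 2)`, at most `δ`.
  let φ : ℕ → ContDiffBump (0 : E) := fun n =>
    ⟨δ / (n + 2) / 2, δ / (n + 2), by positivity, half_lt_self (by positivity)⟩
  have hφ : Tendsto (fun n => (φ n).rOut) atTop (𝓝 0) := by
    have : Tendsto (fun n : ℕ => δ / ((n : ℝ) + 2)) atTop (𝓝 0) :=
      Tendsto.const_div_atTop (tendsto_atTop_add_const_right _ _ tendsto_natCast_atTop_atTop) δ
    exact this
  have hφδ : ∀ n, (φ n).rOut ≤ δ := fun n => div_le_self hδ.le (by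
    have : (0 : ℝ) ≤ n := n.cast_nonneg
    linarith)
  have hball : ∀ x ∈ K, ∀ n, Metric.closedBall x (φ n).rOut ⊆ L := fun x hx n =>
    (Metric.closedBall_subset_closedBall (hφδ n)).trans (Metric.closedBall_subset_cthickening hx δ)
  have hUi : LocallyIntegrable (L.indicator U) μ :=
    ((integrable_indicator_iff hLm).2 hUL).locallyIntegrable
  refine ⟨fun n => (φ n).normed μ ⋆[ContinuousLinearMap.lsmul ℝ ℝ, μ] L.indicator U, max R 0,
    fun n => (φ n).hasCompactSupport_normed.contDiff_convolution_left _ (φ n).contDiff_normed hUi,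
    fun n x => ?_, fun x hx => ?_, fun e => ?_⟩
  · simp only [convolution_def]
    rw [← Real.norm_eq_abs]
    have hi : Integrable (fun t => (φ n).normed μ t * max R 0) μ :=
      (φ n).integrable_normed.mul_const _
    refine (norm_integral_le_of_norm_le hi (Eventually.of_forall fun t => ?_)).trans ?_
    · rw [ContinuousLinearMap.lsmul_apply, norm_smul, Real.norm_of_nonneg ((φ n).nonneg_normed t)]
      exact mul_le_mul_of_nonneg_left (hR' _) ((φ n).nonneg_normed t)
    · rw [integral_mul_const, (φ n).integral_normed, one_mul]
  · have hxL : L ∈ 𝓝 x := mem_of_superset (Metric.closedBall_mem_nhds x hδ)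
      (Metric.closedBall_subset_cthickening hx δ)
    have hcU : ContinuousAt (L.indicator U) x :=
      (hU.continuousAt (hO.mem_nhds (hKO hx))).congr
        (by filter_upwards [hxL] with y hy; rw [indicator_of_mem hy])
    have h := ContDiffBump.convolution_tendsto_right (μ := μ) (g := fun _ : ℕ => L.indicator U)
      (k := fun _ => x) (z₀ := L.indicator U x) hφ
      (Eventually.of_forall fun _ => hUi.aestronglyMeasurable)
      (hcU.tendsto.comp tendsto_snd) tendsto_const_nhds
    rwa [indicator_of_mem (mem_of_mem_nhds hxL)] at h
  · have hbL : MemLp (L.indicator (b e)) 2 μ :=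
      (memLp_indicator_iff_restrict hLm).2 (hb.memLp e L hL hLO)
    have hlim := tendsto_eLpNorm_mollify_sub hbL hφ
    refine tendsto_of_tendsto_of_tendsto_of_le_of_le tendsto_const_nhds hlim
      (fun _ => zero_le) fun n => ?_
    refine (le_of_eq ?_).trans (eLpNorm_mono_measure _ (Measure.restrict_le_self (s := K)))
    refine eLpNorm_congr_ae ?_
    filter_upwards [ae_restrict_mem hK.measurableSet] with x hx
    rw [hb.fderiv_mollify hLm hLO hUL (φ n) x e (hball x hx n),
      indicator_of_mem (Metric.self_subset_cthickening K hx)]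

end WeakDerivative

/-- Products of three sequences, converging boundedly and pointwise, constantly in `L²`, and
strongly in `L²`, can be integrated in the limit. -/
theorem tendsto_integral_mul_mul {α : Type*} [MeasurableSpace α] {ν : Measure α}
    {a : ℕ → α → ℝ} {a' F d' : α → ℝ} {d : ℕ → α → ℝ} {C : ℝ}
    (ham : ∀ n, AEStronglyMeasurable (a n) ν) (haC : ∀ n, ∀ᵐ x ∂ν, |a n x| ≤ C)
    (hat : ∀ᵐ x ∂ν, Tendsto (fun n => a n x) atTop (𝓝 (a' x)))
    (hF : MemLp F 2 ν) (hd : ∀ n, AEStronglyMeasurable (d n) ν) (hd' : MemLp d' 2 ν)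
    (hdt : Tendsto (fun n => eLpNorm (fun x => d n x - d' x) 2 ν) atTop (𝓝 0)) :
    Tendsto (fun n => ∫ x, a n x * (F x * d n x) ∂ν) atTop (𝓝 (∫ x, a' x * (F x * d' x) ∂ν)) := by
  have hFd : Integrable (fun x => F x * d' x) ν := hF.integrable_mul hd'
  have hlim1 : Tendsto (fun n => ∫ x, a n x * (F x * d' x) ∂ν) atTop
      (𝓝 (∫ x, a' x * (F x * d' x) ∂ν)) := by
    refine tendsto_integral_of_dominated_convergence (fun x => C * |F x * d' x|)
      (fun n => (ham n).mul hFd.1) (hFd.abs.const_mul C) (fun n => ?_) ?_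
    · filter_upwards [haC n] with x hx
      rw [Real.norm_eq_abs, abs_mul]
      exact mul_le_mul_of_nonneg_right hx (abs_nonneg _)
    · filter_upwards [hat] with x hx using hx.mul_const _
  have hfin : ∀ᶠ n in atTop, MemLp (fun x => d n x - d' x) 2 ν := by
    filter_upwards [hdt.eventually (gt_mem_nhds ENNReal.zero_lt_top)] with n hn
    exact ⟨(hd n).sub hd'.1, hn⟩
  have hlim2 : Tendsto (fun n => ∫ x, a n x * (F x * (d n x - d' x)) ∂ν) atTop (𝓝 0) := by
    have hbound : Tendsto (fun n => (eLpNorm F 2 ν * eLpNorm (fun x => d n x - d' x) 2 ν).toReal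
        * C) atTop (𝓝 0) := by
      have h1 : Tendsto (fun n => eLpNorm F 2 ν * eLpNorm (fun x => d n x - d' x) 2 ν) atTop
          (𝓝 0) := by
        simpa using ENNReal.Tendsto.const_mul hdt (Or.inr hF.eLpNorm_ne_top)
      simpa using ((ENNReal.tendsto_toReal ENNReal.zero_ne_top).comp h1).mul_const C
    refine squeeze_zero_norm' ?_ hbound
    filter_upwards [hfin] with n hn
    have hi : Integrable (fun x => F x * (d n x - d' x)) ν := hF.integrable_mul hn
    have hC : ∫ x, ‖F x * (d n x - d' x)‖ ∂ν
        ≤ (eLpNorm F 2 ν * eLpNorm (fun x => d n x - d' x) 2 ν).toReal := by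
      rw [integral_norm_eq_lintegral_enorm hi.1, ← eLpNorm_one_eq_lintegral_enorm]
      refine ENNReal.toReal_mono (ENNReal.mul_ne_top hF.eLpNorm_ne_top hn.eLpNorm_ne_top) ?_
      have h := eLpNorm_smul_le_mul_eLpNorm (p := 2) (q := 2) (r := 1) hn.1 hF.1
      exact h
    rcases eq_or_ne ν 0 with h0 | h0
    · simp [h0]
    have : (ae ν).NeBot := ae_neBot.2 h0
    have hC0 : 0 ≤ C := by
      obtain ⟨x, hx⟩ := (haC 0).exists
      exact (abs_nonneg _).trans hx
    refine (norm_integral_le_of_norm_le (hi.norm.mul_const C) ?_).trans ?_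
    · filter_upwards [haC n] with x hx
      rw [norm_mul, mul_comm]
      exact mul_le_mul_of_nonneg_left hx (norm_nonneg _)
    · rw [integral_mul_const]
      exact mul_le_mul_of_nonneg_right hC hC0
  have hsum := hlim1.add hlim2
  rw [add_zero] at hsum
  refine hsum.congr' ?_
  filter_upwards [hfin] with n hn
  have hi : Integrable (fun x => F x * (d n x - d' x)) ν := hF.integrable_mul hn
  rw [← integral_add]
  · congr 1; ext x; ring
  · exact hFd.bdd_mul (ham n) (haC n)
  · exact hi.bdd_mul (ham n) (haC n)

/-! ### The chain rule and non-negative divergence -/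

section Compact

variable {X : Type*} [TopologicalSpace X] [T2Space X] [MeasurableSpace X] [OpensMeasurableSpace X]
  {μ : Measure X}

theorem memLp_restrict_of_continuousOn [IsFiniteMeasureOnCompacts μ] {a : X → ℝ} {K : Set X} (ha : ContinuousOn a K)
    (hK : IsCompact K) (p : ℝ≥0∞) : MemLp a p (μ.restrict K) := by
  have : IsFiniteMeasure (μ.restrict K) := isFiniteMeasure_restrict.2 hK.measure_lt_top.ne
  obtain ⟨C, hC⟩ := hK.exists_bound_of_continuousOn ha
  exact MemLp.of_bound (ha.aestronglyMeasurable hK.measurableSet) C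
    (ae_restrict_of_forall_mem hK.measurableSet hC)

theorem memLp_restrict_continuousOn_mul {a F : X → ℝ} {K : Set X} {p : ℝ≥0∞} (hF : MemLp F p (μ.restrict K))
    (ha : ContinuousOn a K) (hK : IsCompact K) :
    MemLp (fun y => a y * F y) p (μ.restrict K) := by
  obtain ⟨C, hC⟩ := hK.exists_bound_of_continuousOn ha
  refine hF.of_le_mul (c := C) ((ha.aestronglyMeasurable hK.measurableSet).mul hF.1)
    (ae_restrict_of_forall_mem hK.measurableSet fun x hx => ?_)
  rw [norm_mul]
  exact mul_le_mul_of_nonneg_right (hC x hx) (norm_nonneg _)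

theorem exists_bound_comp_of_abs_le {k : ℝ → ℝ} (hk : Continuous k) (R : ℝ) :
    ∃ C, ∀ t, |t| ≤ R → |k t| ≤ C := by
  obtain ⟨C, hC⟩ := (isCompact_Icc (a := -R) (b := R)).exists_bound_of_continuousOn hk.continuousOn
  exact ⟨C, fun t ht => hC t (abs_le.1 ht)⟩

end Compact

section ChainRule

variable {E : Type*} [NormedAddCommGroup E] [NormedSpace ℝ E] [FiniteDimensional ℝ E]
  [MeasurableSpace E] [BorelSpace E] {μ : Measure E} [μ.IsAddHaarMeasure]

/-- The chain rule for weak derivatives: the identity holds for the smooth approximations of `U`,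
and passes to the limit. -/
theorem HasWeakDerivOn.comp {O : Set E} (hO : IsOpen O) {U : E → ℝ} (hU : ContinuousOn U O)
    {b : E → E → ℝ} (hb : HasWeakDerivOn μ O U b) {f h : ℝ → ℝ} (hf : ∀ t, HasDerivAt f (h t) t)
    (hh : Continuous h) :
    HasWeakDerivOn μ O (fun y => f (U y)) (fun e y => h (U y) * b e y) := by
  refine ⟨fun e K hK hKO => memLp_restrict_continuousOn_mul (hb.memLp e K hK hKO)
    (hh.comp_continuousOn (hU.mono hKO)) hK, fun e ψ hψ hψc hψO => ?_⟩
  set K := tsupport ψ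
  have hK : IsCompact K := hψc
  have hfc : Continuous f := continuous_iff_continuousAt.2 fun t => (hf t).continuousAt
  have hψ' : Continuous fun y => fderiv ℝ ψ y e :=
    (hψ.continuous_fderiv (by simp)).clm_apply continuous_const
  have hψ0 : ∀ y, y ∉ K → ψ y = 0 := fun y hy => image_eq_zero_of_notMem_tsupport hy
  have hψd0 : ∀ y, y ∉ K → fderiv ℝ ψ y e = 0 := fun y hy => by
    rw [fderiv_of_notMem_tsupport (𝕜 := ℝ) hy]; simp
  obtain ⟨Un, R, hUns, hUnR, hUnt, hUnd⟩ := hb.exists_smooth_approx hO hK hψO hU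
  obtain ⟨Cf, hCf⟩ := exists_bound_comp_of_abs_le hfc R
  obtain ⟨Ch, hCh⟩ := exists_bound_comp_of_abs_le hh R
  have hdUn : ∀ n, Continuous fun y => fderiv ℝ (Un n) y e := fun n =>
    ((hUns n).continuous_fderiv (by simp)).clm_apply continuous_const
  have hparts : ∀ n, ∫ y in K, f (Un n y) * (fderiv ℝ ψ y e * 1) ∂μ
      = - ∫ y in K, h (Un n y) * (ψ y * fderiv ℝ (Un n) y e) ∂μ := by
    intro n
    have hd : ∀ y, HasFDerivAt (fun y => f (Un n y)) (h (Un n y) • fderiv ℝ (Un n) y) y :=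
      fun y => (hf (Un n y)).comp_hasFDerivAt y
        ((hUns n).differentiable (by simp) y).hasFDerivAt
    have hcfU : Continuous fun y => f (Un n y) := hfc.comp (hUns n).continuous
    have hchU : Continuous fun y => h (Un n y) := hh.comp (hUns n).continuous
    have he : ∀ y, fderiv ℝ (fun y => f (Un n y)) y e * ψ y
        = h (Un n y) * (ψ y * fderiv ℝ (Un n) y e) := fun y => by
      rw [(hd y).fderiv]; simp; ring
    have hi1 : Integrable (fun y => h (Un n y) * (ψ y * fderiv ℝ (Un n) y e)) μ :=
      (hchU.mul (hψ.continuous.mul (hdUn n))).integrable_of_hasCompactSupport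
        (hψc.mul_right.mul_left)
    have hi2 : Integrable (fun y => f (Un n y) * fderiv ℝ ψ y e) μ :=
      (hcfU.mul hψ').integrable_of_hasCompactSupport
        ((hψc.fderiv_apply (𝕜 := ℝ) e).mul_left)
    have h1 := integral_mul_fderiv_eq_neg_fderiv_mul_of_integrable (μ := μ)
      (f := fun y => f (Un n y)) (g := ψ) (v := e) (by simpa only [he] using hi1) hi2
      ((hcfU.mul hψ.continuous).integrable_of_hasCompactSupport hψc.mul_left)
      (fun y _ => (hd y).differentiableAt) (fun y _ => hψ.differentiable (by simp) y)
    simp_rw [he] at h1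
    rw [setIntegral_eq_integral_of_forall_compl_eq_zero (fun y hy => by rw [hψd0 y hy]; ring),
      setIntegral_eq_integral_of_forall_compl_eq_zero (fun y hy => by rw [hψ0 y hy]; ring), ← h1]
    simp
  have haeK : ∀ {p : E → Prop}, (∀ y ∈ K, p y) → ∀ᵐ y ∂(μ.restrict K), p y :=
    fun hp => ae_restrict_of_forall_mem hK.measurableSet hp
  have hlim1 : Tendsto (fun n => ∫ y in K, f (Un n y) * (fderiv ℝ ψ y e * 1) ∂μ) atTop
      (𝓝 (∫ y in K, f (U y) * (fderiv ℝ ψ y e * 1) ∂μ)) := by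
    refine tendsto_integral_mul_mul (C := Cf)
      (fun n => (hfc.comp (hUns n).continuous).aestronglyMeasurable)
      (fun n => haeK fun y _ => hCf _ (hUnR n y))
      (haeK fun y hy => (hfc.tendsto _).comp (hUnt y hy))
      (memLp_restrict_of_continuousOn hψ'.continuousOn hK 2)
      (d := fun _ _ => 1) (d' := fun _ => 1) (fun n => aestronglyMeasurable_const)
      (memLp_restrict_of_continuousOn continuousOn_const hK 2) ?_
    simp
  have hlim2 : Tendsto (fun n => ∫ y in K, h (Un n y) * (ψ y * fderiv ℝ (Un n) y e) ∂μ) atTop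
      (𝓝 (∫ y in K, h (U y) * (ψ y * b e y) ∂μ)) :=
    tendsto_integral_mul_mul (C := Ch)
      (fun n => (hh.comp (hUns n).continuous).aestronglyMeasurable)
      (fun n => haeK fun y _ => hCh _ (hUnR n y))
      (haeK fun y hy => (hh.tendsto _).comp (hUnt y hy))
      (memLp_restrict_of_continuousOn hψ.continuous.continuousOn hK 2)
      (fun n => (hdUn n).aestronglyMeasurable) (hb.memLp e K hK hψO) (hUnd e)
  have heq := tendsto_nhds_unique hlim1 (by simpa only [hparts] using hlim2.neg)
  rw [setIntegral_eq_integral_of_forall_compl_eq_zero (fun y hy => by rw [hψd0 y hy]; ring),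
    setIntegral_eq_integral_of_forall_compl_eq_zero (fun y hy => by rw [hψ0 y hy]; ring)] at heq
  simp only [mul_one] at heq
  rw [heq]
  congr 2
  ext y; ring

/-- Let the vector field with coefficients `F i` along the vectors `ε i` have non-negative
divergence in the weak sense. If it makes an acute angle with the weak gradient of `U`, then its
product with a non-negative increasing function of `U` again has non-negative divergence:
formally, `div (h(U) F) = h(U) div F + h'(U) ⟨F, ∇U⟩`. -/
theorem HasWeakDerivOn.integral_comp_mul_nonpos {ι : Type*} [Fintype ι] {ε : ι → E} {O : Set E}
    (hO : IsOpen O) {U : E → ℝ} (hU : ContinuousOn U O) {b : E → E → ℝ}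
    (hb : HasWeakDerivOn μ O U b) {F : ι → E → ℝ}
    (hF : ∀ i K, IsCompact K → K ⊆ O → MemLp (F i) 2 (μ.restrict K))
    (hFb : ∀ y ∈ O, 0 ≤ ∑ i, F i y * b (ε i) y)
    (hdiv : ∀ η : E → ℝ, ContDiff ℝ ∞ η → HasCompactSupport η → tsupport η ⊆ O → (∀ y, 0 ≤ η y) →
      ∫ y, ∑ i, F i y * fderiv ℝ η y (ε i) ∂μ ≤ 0)
    {h : ℝ → ℝ} (hh : ContDiff ℝ ∞ h) (hh0 : ∀ t, 0 ≤ h t) (hmono : Monotone h)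
    {η : E → ℝ} (hη : ContDiff ℝ ∞ η) (hηc : HasCompactSupport η) (hηO : tsupport η ⊆ O)
    (hη0 : ∀ y, 0 ≤ η y) :
    ∫ y, h (U y) * ∑ i, F i y * fderiv ℝ η y (ε i) ∂μ ≤ 0 := by
  set K := tsupport η
  have hK : IsCompact K := hηc
  have hη' : ∀ i, Continuous fun y => fderiv ℝ η y (ε i) := fun i =>
    (hη.continuous_fderiv (by simp)).clm_apply continuous_const
  have hηz : ∀ y, y ∉ K → η y = 0 := fun y hy => image_eq_zero_of_notMem_tsupport hy
  have hηd0 : ∀ y, y ∉ K → fderiv ℝ η y = 0 := fun y hy => fderiv_of_notMem_tsupport (𝕜 := ℝ) hy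
  have hh' : Continuous (deriv h) := hh.continuous_deriv (by simp)
  have hh'0 : ∀ t, 0 ≤ deriv h t := fun t => hmono.deriv_nonneg
  obtain ⟨Un, R, hUns, hUnR, hUnt, hUnd⟩ := hb.exists_smooth_approx hO hK hηO hU
  obtain ⟨C, hC⟩ := exists_bound_comp_of_abs_le hh.continuous R
  obtain ⟨C', hC'⟩ := exists_bound_comp_of_abs_le hh' R
  have hdUn : ∀ n i, Continuous fun y => fderiv ℝ (Un n) y (ε i) := fun n i =>
    ((hUns n).continuous_fderiv (by simp)).clm_apply continuous_const
  have hFK : ∀ i, MemLp (F i) 2 (μ.restrict K) := fun i => hF i K hK hηO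
  have hFη : ∀ i, MemLp (fun y => η y * F i y) 2 (μ.restrict K) := fun i =>
    memLp_restrict_continuousOn_mul (hFK i) hη.continuous.continuousOn hK
  have hUc : ContinuousOn U K := hU.mono hηO
  have hcont : ∀ {a : E → ℝ}, ContinuousOn a K → MemLp a 2 (μ.restrict K) :=
    fun ha => memLp_restrict_of_continuousOn ha hK 2
  have haeK : ∀ {p : E → Prop}, (∀ y ∈ K, p y) → ∀ᵐ y ∂(μ.restrict K), p y :=
    fun hp => ae_restrict_of_forall_mem hK.measurableSet hp
  -- The product `h(Un) η` is an admissible test function, because `Un` is smooth.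
  have htest : ∀ n, ∑ i, ((∫ y in K, h (Un n y) * (F i y * fderiv ℝ η y (ε i)) ∂μ)
      + ∫ y in K, deriv h (Un n y) * ((η y * F i y) * fderiv ℝ (Un n) y (ε i)) ∂μ) ≤ 0 := by
    intro n
    have hhU : ContDiff ℝ ∞ fun y => h (Un n y) := hh.comp (hUns n)
    have hts : tsupport (fun y => h (Un n y) * η y) ⊆ K := tsupport_mul_subset_right
    have h1 := hdiv (fun y => h (Un n y) * η y) (hhU.mul hη) hηc.mul_left (hts.trans hηO)
      (fun y => mul_nonneg (hh0 _) (hη0 y))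
    have hd : ∀ y i, fderiv ℝ (fun y => h (Un n y) * η y) y (ε i)
        = h (Un n y) * fderiv ℝ η y (ε i) + η y * (deriv h (Un n y) * fderiv ℝ (Un n) y (ε i)) := by
      intro y i
      have hd1 : HasFDerivAt (fun y => h (Un n y)) (deriv h (Un n y) • fderiv ℝ (Un n) y) y :=
        ((hh.differentiable (by simp)) (Un n y)).hasDerivAt.comp_hasFDerivAt y
          ((hUns n).differentiable (by simp) y).hasFDerivAt
      have hd2 := hd1.mul ((hη.differentiable (by simp)) y).hasFDerivAt
      have hd3 : fderiv ℝ (fun y => h (Un n y) * η y) y = _ := hd2.fderiv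
      rw [hd3]
      simp
    have hi1 : ∀ i, Integrable (fun y => h (Un n y) * (F i y * fderiv ℝ η y (ε i)))
        (μ.restrict K) := fun i =>
      memLp_one_iff_integrable.1 (memLp_restrict_continuousOn_mul (memLp_one_iff_integrable.2
        ((hFK i).integrable_mul (hcont (hη' i).continuousOn))) hhU.continuous.continuousOn hK)
    have hi2 : ∀ i, Integrable
        (fun y => deriv h (Un n y) * ((η y * F i y) * fderiv ℝ (Un n) y (ε i)))
        (μ.restrict K) := fun i =>
      memLp_one_iff_integrable.1 (memLp_restrict_continuousOn_mul (memLp_one_iff_integrable.2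
        ((hFη i).integrable_mul (hcont (hdUn n i).continuousOn)))
        (hh'.comp (hUns n).continuous).continuousOn hK)
    refine le_trans (le_of_eq ?_) h1
    rw [← setIntegral_eq_integral_of_forall_compl_eq_zero (s := K) (fun y hy => ?_)]
    · rw [Finset.sum_add_distrib, ← integral_finsetSum _ fun i _ => hi1 i,
        ← integral_finsetSum _ fun i _ => hi2 i,
        ← integral_add (integrable_finsetSum _ fun i _ => hi1 i)
          (integrable_finsetSum _ fun i _ => hi2 i)]
      congr 1
      ext y
      rw [← Finset.sum_add_distrib]
      refine Finset.sum_congr rfl fun i _ => ?_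
      rw [hd]; ring
    · refine Finset.sum_eq_zero fun i _ => ?_
      rw [hd, hηd0 y hy, hηz y hy]; simp
  have hlim : Tendsto (fun n => ∑ i, ((∫ y in K, h (Un n y) * (F i y * fderiv ℝ η y (ε i)) ∂μ)
      + ∫ y in K, deriv h (Un n y) * ((η y * F i y) * fderiv ℝ (Un n) y (ε i)) ∂μ)) atTop
      (𝓝 (∑ i, ((∫ y in K, h (U y) * (F i y * fderiv ℝ η y (ε i)) ∂μ)
      + ∫ y in K, deriv h (U y) * ((η y * F i y) * b (ε i) y) ∂μ))) := by
    refine tendsto_finsetSum _ fun i _ => Tendsto.add ?_ ?_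
    · refine tendsto_integral_mul_mul (C := C)
        (fun n => (hh.continuous.comp (hUns n).continuous).aestronglyMeasurable)
        (fun n => haeK fun y _ => hC _ (hUnR n y))
        (haeK fun y hy => (hh.continuous.tendsto _).comp (hUnt y hy))
        (hFK i) (d := fun _ y => fderiv ℝ η y (ε i))
        (fun n => (hη' i).aestronglyMeasurable) (hcont (hη' i).continuousOn) ?_
      simp
    · exact tendsto_integral_mul_mul (C := C')
        (fun n => (hh'.comp (hUns n).continuous).aestronglyMeasurable)
        (fun n => haeK fun y _ => hC' _ (hUnR n y))
        (haeK fun y hy => (hh'.tendsto _).comp (hUnt y hy))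
        (hFη i) (fun n => (hdUn n i).aestronglyMeasurable) (hb.memLp _ K hK hηO) (hUnd _)
  have hle := le_of_tendsto' hlim htest
  have hi1 : ∀ i, Integrable (fun y => h (U y) * (F i y * fderiv ℝ η y (ε i)))
      (μ.restrict K) := fun i =>
    memLp_one_iff_integrable.1 (memLp_restrict_continuousOn_mul (memLp_one_iff_integrable.2
      ((hFK i).integrable_mul (hcont (hη' i).continuousOn)))
      (hh.continuous.comp_continuousOn hUc) hK)
  have hi2 : ∀ i, Integrable (fun y => deriv h (U y) * ((η y * F i y) * b (ε i) y))
      (μ.restrict K) := fun i =>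
    memLp_one_iff_integrable.1 (memLp_restrict_continuousOn_mul (memLp_one_iff_integrable.2
      ((hFη i).integrable_mul (hb.memLp _ K hK hηO))) (hh'.comp_continuousOn hUc) hK)
  rw [Finset.sum_add_distrib, ← integral_finsetSum _ fun i _ => hi1 i,
    ← integral_finsetSum _ fun i _ => hi2 i] at hle
  have hpos : 0 ≤ ∫ y in K, ∑ i, deriv h (U y) * ((η y * F i y) * b (ε i) y) ∂μ := by
    refine setIntegral_nonneg hK.measurableSet fun y hy => ?_
    have : ∑ i, deriv h (U y) * ((η y * F i y) * b (ε i) y)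
        = deriv h (U y) * (η y * ∑ i, F i y * b (ε i) y) := by
      rw [Finset.mul_sum, Finset.mul_sum]
      exact Finset.sum_congr rfl fun i _ => by ring
    rw [this]
    exact mul_nonneg (hh'0 _) (mul_nonneg (hη0 y) (hFb y (hηO hy)))
  rw [← setIntegral_eq_integral_of_forall_compl_eq_zero (s := K)
    (fun y hy => by rw [hηd0 y hy]; simp)]
  simp_rw [Finset.mul_sum]
  linarith

end ChainRule

/-! ### The Gram matrix of a chart -/

section Measurable

variable {α β : Type*} [TopologicalSpace α] [MeasurableSpace α] [OpensMeasurableSpace α]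
  [TopologicalSpace β] [MeasurableSpace β] [BorelSpace β]

theorem measurableSet_inter_preimage_of_continuousOn {f : α → β} {s : Set α} {t : Set β}
    (hf : ContinuousOn f s) (hs : MeasurableSet s) (ht : MeasurableSet t) :
    MeasurableSet (s ∩ f ⁻¹' t) := by
  have h := (continuousOn_iff_continuous_domRestrict.1 hf).measurable ht
  have h2 := MeasurableSet.subtype_image hs h
  convert h2 using 1
  ext x
  simp [and_comm]

end Measurable

section Charts

variable {m : ℕ} [NeZero m] {M : Type*} [TopologicalSpace M]
  [ChartedSpace (EuclideanHalfSpace m) M]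

theorem measurableSet_extChartAt_target (p : M) :
    MeasurableSet (extChartAt (𝓡∂ m) p).target := by
  rw [extChartAt_target]
  exact (((chartAt _ p).open_target.preimage (𝓡∂ m).continuous_symm).measurableSet).inter
    (𝓡∂ m).isClosed_range.measurableSet

theorem continuousOn_param (p : M) : ContinuousOn (param p) (extChartAt (𝓡∂ m) p).target :=
  continuousOn_extChartAt_symm p

theorem param_mem_source {p : M} {y : Coord m} (hy : y ∈ (extChartAt (𝓡∂ m) p).target) :
    param p y ∈ (extChartAt (𝓡∂ m) p).source := (extChartAt (𝓡∂ m) p).map_target hy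

theorem extChartAt_param {p : M} {y : Coord m} (hy : y ∈ (extChartAt (𝓡∂ m) p).target) :
    extChartAt (𝓡∂ m) p (param p y) = y := (extChartAt (𝓡∂ m) p).right_inv hy

theorem param_extChartAt {p x : M} (hx : x ∈ (extChartAt (𝓡∂ m) p).source) :
    param p (extChartAt (𝓡∂ m) p x) = x := (extChartAt (𝓡∂ m) p).left_inv hx

/-- The map `e ↦ ∑ i, e i • ∂/∂y_i` as a continuous linear map. -/
noncomputable def coordFrame (p : M) (y : Coord m) :
    Coord m →L[ℝ] TangentSpace (𝓡∂ m) (param p y) :=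
  mfderivWithin 𝓘(ℝ, Coord m) (𝓡∂ m) (extChartAt (𝓡∂ m) p).symm (range (𝓡∂ m)) y

theorem coordVector_eq_sum (p : M) (y v : Coord m) :
    coordVector p y v = ∑ i, v i • coordVector p y (EuclideanSpace.single i 1) := by
  have h : v = ∑ i, v i • EuclideanSpace.single i (1 : ℝ) := by
    have := (EuclideanSpace.basisFun (Fin m) ℝ).sum_repr v
    simpa using this.symm
  change coordFrame p y v = ∑ i, v i • coordFrame p y (EuclideanSpace.single i 1)
  conv_lhs => rw [h]
  rw [map_sum]
  simp_rw [map_smul]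

variable [IsManifold (𝓡∂ m) ∞ M]

theorem inner_congr (g : Metric m M) {x z : M} (h : x = z) (v w : Coord m) :
    g.inner x v w = g.inner z v w := by subst h; rfl

theorem isManifold_one : IsManifold (𝓡∂ m) 1 M :=
  IsManifold.of_le (n := ∞) (by simp)

theorem continuousOn_inner_symmL (g : Metric m M) (p : M) (e e' : Coord m) :
    ContinuousOn (fun x => g.inner x
      ((trivializationAt (Coord m) (TangentSpace (𝓡∂ m)) p).symmL ℝ x e)
      ((trivializationAt (Coord m) (TangentSpace (𝓡∂ m)) p).symmL ℝ x e'))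
      (extChartAt (𝓡∂ m) p).source := by
  have : IsManifold (𝓡∂ m) 1 M := isManifold_one
  set t := trivializationAt (Coord m) (TangentSpace (𝓡∂ m) (M := M)) p with ht
  have hs : ∀ e : Coord m, ContMDiffOn (𝓡∂ m) ((𝓡∂ m).prod 𝓘(ℝ, Coord m)) ∞
      (fun x => Bundle.TotalSpace.mk' (Coord m) x (t.symmL ℝ x e)) t.baseSet := by
    intro e
    rw [t.contMDiffOn_section_baseSet_iff]
    refine (contMDiffOn_const (c := e)).congr fun y hy => ?_
    rw [t.symmL_apply hy, t.apply_mk_symm hy]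
  have h2 := ContMDiffOn.clm_bundle_apply₂ (g.contMDiff.contMDiffOn (s := t.baseSet)) (hs e) (hs e')
  have hb : t.baseSet = (extChartAt (𝓡∂ m) p).source := by
    rw [extChartAt_source, ht, TangentBundle.trivializationAt_baseSet]
  rw [← hb]
  intro x hx
  exact (Bundle.contMDiffWithinAt_section.1 (h2 x hx)).continuousWithinAt

/-- The coordinate vector fields come from the trivialization of the tangent bundle given by the
chart. -/
theorem inner_coordVector_eq_symmL (g : Metric m M) (p : M) {y : Coord m}
    (hy : y ∈ (extChartAt (𝓡∂ m) p).target) (e e' : Coord m) :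
    g.inner (param p y) (coordVector p y e) (coordVector p y e') = g.inner (param p y)
      ((trivializationAt (Coord m) (TangentSpace (𝓡∂ m)) p).symmL ℝ (param p y) e)
      ((trivializationAt (Coord m) (TangentSpace (𝓡∂ m)) p).symmL ℝ (param p y) e') := by
  have : IsManifold (𝓡∂ m) 1 M := isManifold_one
  have hx : param p y ∈ (chartAt (EuclideanHalfSpace m) p).source := by
    rw [← extChartAt_source (𝓡∂ m)]; exact param_mem_source hy
  rw [TangentBundle.symmL_trivializationAt hx, extChartAt_param hy]
  rfl

theorem continuousOn_gramMatrix (g : Metric m M) (p : M) (i j : Fin m) :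
    ContinuousOn (fun y => gramMatrix g p y i j) (extChartAt (𝓡∂ m) p).target := by
  refine ((continuousOn_inner_symmL g p (EuclideanSpace.single i 1)
    (EuclideanSpace.single j 1)).comp (continuousOn_param p)
    fun y hy => param_mem_source hy).congr fun y hy => ?_
  exact inner_coordVector_eq_symmL g p hy _ _

/-- The Gram matrix is the matrix of the scalar product in the frame of coordinate vectors. -/
theorem inner_coordVector (g : Metric m M) (p : M) (y v w : Coord m) :
    g.inner (param p y) (coordVector p y v) (coordVector p y w)
      = ∑ i, ∑ j, v i * w j * gramMatrix g p y i j := by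
  rw [coordVector_eq_sum p y v, coordVector_eq_sum p y w]
  simp only [map_sum, map_smul, sum_apply, smul_apply,
    smul_eq_mul, gramMatrix, Matrix.of_apply, Finset.mul_sum]
  rw [Finset.sum_comm]
  refine Finset.sum_congr rfl fun i _ => Finset.sum_congr rfl fun j _ => by ring

theorem mfderiv_extChartAt_coordVector {p : M} {y : Coord m}
    (hy : y ∈ (extChartAt (𝓡∂ m) p).target) (v : Coord m) :
    mfderiv (𝓡∂ m) 𝓘(ℝ, Coord m) (extChartAt (𝓡∂ m) p) (param p y) (coordVector p y v) = v := by
  have : IsManifold (𝓡∂ m) 1 M := isManifold_one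
  exact congrArg (fun L => L v) (mfderiv_extChartAt_comp_mfderivWithin_extChartAt_symm hy)

theorem coordVector_mfderiv_extChartAt {p : M} {y : Coord m}
    (hy : y ∈ (extChartAt (𝓡∂ m) p).target) (V : TangentSpace (𝓡∂ m) (param p y)) :
    coordVector p y (mfderiv (𝓡∂ m) 𝓘(ℝ, Coord m) (extChartAt (𝓡∂ m) p) (param p y) V) = V := by
  have : IsManifold (𝓡∂ m) 1 M := isManifold_one
  exact congrArg (fun L => L V) (mfderivWithin_extChartAt_symm_comp_mfderiv_extChartAt hy)

theorem det_gramMatrix_pos (g : Metric m M) {p : M} {y : Coord m}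
    (hy : y ∈ (extChartAt (𝓡∂ m) p).target) : 0 < (gramMatrix g p y).det := by
  refine Matrix.PosDef.det_pos (Matrix.PosDef.of_dotProduct_mulVec_pos ?_ fun v hv => ?_)
  · ext i j
    simp only [Matrix.conjTranspose_apply, gramMatrix, Matrix.of_apply, star_trivial]
    exact g.symm _ _ _
  · set w : Coord m := WithLp.toLp 2 v
    have hw : coordVector p y w ≠ 0 := by
      intro h0
      have h1 := mfderiv_extChartAt_coordVector hy w
      rw [h0, map_zero] at h1
      exact hv (congrArg WithLp.ofLp h1.symm)
    have h := g.pos _ _ hw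
    rw [inner_coordVector] at h
    refine lt_of_lt_of_eq h (Eq.symm ?_)
    simp only [dotProduct, Matrix.mulVec, star_trivial, Finset.mul_sum, Pi.star_apply]
    refine Finset.sum_congr rfl fun i _ => Finset.sum_congr rfl fun j _ => ?_
    change v i * (gramMatrix g p y i j * v j) = v i * v j * gramMatrix g p y i j
    ring

/-- The density `√(det g_ij)` of the Riemannian volume in the chart at `p`. -/
noncomputable def volDensity (g : Metric m M) (p : M) (y : Coord m) : ℝ := Real.sqrt (gramMatrix g p y).det

theorem continuousOn_det_gramMatrix (g : Metric m M) (p : M) :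
    ContinuousOn (fun y => (gramMatrix g p y).det) (extChartAt (𝓡∂ m) p).target := by
  simp_rw [Matrix.det_apply]
  exact continuousOn_finsetSum _ fun σ _ => (continuousOn_finsetProd _ fun i _ =>
    continuousOn_gramMatrix g p _ _).const_smul _

theorem continuousOn_volDensity (g : Metric m M) (p : M) :
    ContinuousOn (volDensity g p) (extChartAt (𝓡∂ m) p).target :=
  (continuousOn_det_gramMatrix g p).sqrt

theorem continuousOn_inv_gramMatrix (g : Metric m M) (p : M) (i j : Fin m) :
    ContinuousOn (fun y => (gramMatrix g p y)⁻¹ i j) (extChartAt (𝓡∂ m) p).target := by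
  simp_rw [Matrix.inv_def, Matrix.smul_apply, Matrix.adjugate_apply, Matrix.det_apply,
    Ring.inverse_eq_inv', smul_eq_mul]
  refine ContinuousOn.mul (ContinuousOn.inv₀ ?_ fun y hy => ?_) ?_
  · simpa only [Matrix.det_apply] using continuousOn_det_gramMatrix g p
  · have := (det_gramMatrix_pos g hy).ne'
    rwa [Matrix.det_apply] at this
  · refine continuousOn_finsetSum _ fun σ _ => (continuousOn_finsetProd _ fun k _ => ?_).const_smul _
    simp only [Matrix.updateRow_apply]
    split_ifs
    · exact continuousOn_const
    · exact continuousOn_gramMatrix g p _ _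

end Charts

/-! ### The Riemannian volume in a chart -/

section Volume

variable {m : ℕ} [NeZero m] {M : Type*} [TopologicalSpace M]
  [ChartedSpace (EuclideanHalfSpace m) M]

/-- The derivative, at the point with coordinates `y` in the chart at `q`, of the transition map
from the chart at `q` to the chart at `p`. -/
noncomputable def transitionDeriv (p q : M) (y : Coord m) : Coord m →L[ℝ] Coord m :=
  (mfderiv (𝓡∂ m) 𝓘(ℝ, Coord m) (extChartAt (𝓡∂ m) p) (param q y)).comp (coordFrame q y)

theorem measurableEmbedding_param [MeasurableSpace M] [BorelSpace M] (p : M) :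
    MeasurableEmbedding fun y : (extChartAt (𝓡∂ m) p).target => param p (y : Coord m) where
  injective := fun y z h => by
    have h' : param p (y : Coord m) = param p (z : Coord m) := h
    exact Subtype.ext (by rw [← extChartAt_param y.2, ← extChartAt_param z.2, h'])
  measurable := (continuousOn_iff_continuous_domRestrict.1 (continuousOn_param p)).measurable
  measurableSet_image' := fun {s} hs => by
    have h1 : MeasurableSet (Subtype.val '' s) :=
      MeasurableSet.subtype_image (measurableSet_extChartAt_target p) hs
    have h2 := measurableSet_inter_preimage_of_continuousOn (continuousOn_extChartAt (I := 𝓡∂ m) p)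
      (isOpen_extChartAt_source p).measurableSet h1
    convert h2 using 1
    ext x
    constructor
    · rintro ⟨y, hy, rfl⟩
      exact ⟨param_mem_source y.2, y, hy, (extChartAt_param y.2).symm⟩
    · rintro ⟨hx, y, hy, hyx⟩
      exact ⟨y, hy, by simp only; rw [hyx, param_extChartAt hx]⟩

variable [IsManifold (𝓡∂ m) ∞ M]

theorem hasFDerivWithinAt_transition {p q : M} {y : Coord m}
    (hy : y ∈ (extChartAt (𝓡∂ m) q).target) (hyp : param q y ∈ (extChartAt (𝓡∂ m) p).source) :
    HasFDerivWithinAt (fun z => extChartAt (𝓡∂ m) p (param q z)) (transitionDeriv p q y)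
      (range (𝓡∂ m)) y := by
  have : IsManifold (𝓡∂ m) 1 M := isManifold_one
  rw [extChartAt_source] at hyp
  exact ((mdifferentiableAt_extChartAt hyp).hasMFDerivAt.comp_hasMFDerivWithinAt y
    (mdifferentiableWithinAt_extChartAt_symm hy).hasMFDerivWithinAt).hasFDerivWithinAt

/-- The transition derivative expresses the coordinate vectors of one chart in those of the
other. -/
theorem inner_coordVector_transition (g : Metric m M) {p q : M} {y : Coord m}
    (hyp : param q y ∈ (extChartAt (𝓡∂ m) p).source) (v w : Coord m) :
    g.inner (param p (extChartAt (𝓡∂ m) p (param q y)))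
      (coordVector p (extChartAt (𝓡∂ m) p (param q y)) (transitionDeriv p q y v))
      (coordVector p (extChartAt (𝓡∂ m) p (param q y)) (transitionDeriv p q y w))
      = g.inner (param q y) (coordVector q y v) (coordVector q y w) := by
  have : IsManifold (𝓡∂ m) 1 M := isManifold_one
  have h : ∀ V : TangentSpace (𝓡∂ m) (param q y),
      (coordVector p (extChartAt (𝓡∂ m) p (param q y))
        (mfderiv (𝓡∂ m) 𝓘(ℝ, Coord m) (extChartAt (𝓡∂ m) p) (param q y) V) : Coord m) = V :=
    fun V => congrArg (fun L => L V) (mfderivWithin_extChartAt_symm_comp_mfderiv_extChartAt' hyp)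
  refine (inner_congr g (param_extChartAt hyp) _ _).trans ?_
  exact congrArg₂ (fun a b : Coord m => g.inner (param q y) a b) (h _) (h _)

theorem gramMatrix_transition (g : Metric m M) {p q : M} {y : Coord m}
    (hyp : param q y ∈ (extChartAt (𝓡∂ m) p).source) :
    gramMatrix g q y = (LinearMap.toMatrix (EuclideanSpace.basisFun (Fin m) ℝ).toBasis
        (EuclideanSpace.basisFun (Fin m) ℝ).toBasis
        (transitionDeriv p q y : Coord m →ₗ[ℝ] Coord m)).transpose
      * gramMatrix g p (extChartAt (𝓡∂ m) p (param q y))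
      * LinearMap.toMatrix (EuclideanSpace.basisFun (Fin m) ℝ).toBasis
        (EuclideanSpace.basisFun (Fin m) ℝ).toBasis
        (transitionDeriv p q y : Coord m →ₗ[ℝ] Coord m) := by
  ext i j
  have h := inner_coordVector_transition g hyp (EuclideanSpace.single i 1)
    (EuclideanSpace.single j 1)
  rw [inner_coordVector] at h
  rw [show gramMatrix g q y i j = _ from h.symm]
  simp only [Matrix.mul_apply, Matrix.transpose_apply, LinearMap.toMatrix_apply,
    Finset.sum_mul, OrthonormalBasis.coe_toBasis, EuclideanSpace.basisFun_apply,
    OrthonormalBasis.coe_toBasis_repr_apply, EuclideanSpace.basisFun_repr]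
  rw [Finset.sum_comm]
  refine Finset.sum_congr rfl fun k _ => Finset.sum_congr rfl fun l _ => ?_
  simp only [ContinuousLinearMap.coe_coe]
  ring

/-- The density `√(det g_ij)` transforms by the absolute value of the Jacobian determinant. -/
theorem volDensity_transition (g : Metric m M) {p q : M} {y : Coord m}
    (hyp : param q y ∈ (extChartAt (𝓡∂ m) p).source) :
    |(transitionDeriv p q y).det| * volDensity g p (extChartAt (𝓡∂ m) p (param q y))
      = volDensity g q y := by
  unfold volDensity
  rw [gramMatrix_transition g hyp, Matrix.det_mul, Matrix.det_mul, Matrix.det_transpose,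
    LinearMap.det_toMatrix]
  change |LinearMap.det (transitionDeriv p q y : Coord m →ₗ[ℝ] Coord m)| * _ = _
  set d := LinearMap.det (transitionDeriv p q y : Coord m →ₗ[ℝ] Coord m)
  rw [mul_right_comm, Real.sqrt_mul (mul_self_nonneg d), Real.sqrt_mul_self_eq_abs]

theorem volDensity_nonneg (g : Metric m M) (p : M) (y : Coord m) : 0 ≤ volDensity g p y :=
  Real.sqrt_nonneg _

theorem aemeasurable_volDensity (g : Metric m M) (p : M) :
    AEMeasurable (fun y => ENNReal.ofReal (volDensity g p y))
      (volume.restrict (extChartAt (𝓡∂ m) p).target) :=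
  ((continuousOn_volDensity g p).aemeasurable (measurableSet_extChartAt_target p)).ennreal_ofReal

theorem map_comap_withDensity_target (g : Metric m M) (p : M) :
    (Measure.comap Subtype.val ((volume.restrict (extChartAt (𝓡∂ m) p).target).withDensity
        fun y => ENNReal.ofReal (volDensity g p y))).map
      (Subtype.val : (extChartAt (𝓡∂ m) p).target → Coord m)
      = (volume.restrict (extChartAt (𝓡∂ m) p).target).withDensity
        fun y => ENNReal.ofReal (volDensity g p y) := by
  have ht := measurableSet_extChartAt_target (m := m) p
  rw [map_comap_subtype_coe ht, restrict_withDensity ht, Measure.restrict_restrict ht, inter_self]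

variable [MeasurableSpace M] [BorelSpace M]

theorem chartVolume_apply (g : Metric m M) (p : M) {s : Set M} (hs : MeasurableSet s) :
    chartVolume g p s = ∫⁻ y in (extChartAt (𝓡∂ m) p).target ∩ param p ⁻¹' s,
      ENNReal.ofReal (volDensity g p y) := by
  have ht := measurableSet_extChartAt_target (m := m) p
  have hm : AEMeasurable (param (m := m) (M := M) p) ((volume.restrict (extChartAt (𝓡∂ m) p).target).withDensity
      (fun y => ENNReal.ofReal (Real.sqrt (gramMatrix g p y).det))) :=
    ((continuousOn_param p).aemeasurable ht).mono_ac (withDensity_absolutelyContinuous _ _)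
  rw [chartVolume, Measure.map_apply_of_aemeasurable hm hs, withDensity_apply',
    Measure.restrict_restrict' ht, inter_comm]
  rfl

/-- The Riemannian volumes of two chart domains agree on their overlap, by the change of variables
formula. One inequality suffices, as the roles of the charts can be exchanged. -/
theorem chartVolume_le_of_subset_source (g : Metric m M) (p q : M) {s : Set M}
    (hs : MeasurableSet s) (hsp : s ⊆ (extChartAt (𝓡∂ m) p).source) :
    chartVolume g q s ≤ chartVolume g p s := by
  rw [chartVolume_apply g q hs, chartVolume_apply g p hs]
  set S := (extChartAt (𝓡∂ m) q).target ∩ param q ⁻¹' s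
  have hS : MeasurableSet S := measurableSet_inter_preimage_of_continuousOn (continuousOn_param q)
    (measurableSet_extChartAt_target q) hs
  have hinj : InjOn (fun z => extChartAt (𝓡∂ m) p (param q z)) S := by
    intro y hy z hz h
    have h2 : param q y = param q z := (extChartAt (𝓡∂ m) p).injOn (hsp hy.2) (hsp hz.2) h
    rw [← extChartAt_param hy.1, ← extChartAt_param hz.1, h2]
  have hsub : (fun z => extChartAt (𝓡∂ m) p (param q z)) '' S
      ⊆ (extChartAt (𝓡∂ m) p).target ∩ param p ⁻¹' s := by
    rintro _ ⟨y, hy, rfl⟩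
    refine ⟨(extChartAt (𝓡∂ m) p).map_source (hsp hy.2), ?_⟩
    simp only [mem_preimage]
    rw [param_extChartAt (hsp hy.2)]
    exact hy.2
  refine le_trans (le_of_eq ?_) (lintegral_mono_set hsub)
  rw [lintegral_image_eq_lintegral_abs_det_fderiv_mul volume hS
    (fun y hy => (hasFDerivWithinAt_transition hy.1 (hsp hy.2)).mono
      fun z hz => extChartAt_target_subset_range q hz.1) hinj]
  refine setLIntegral_congr_fun hS fun y hy => ?_
  rw [← ENNReal.ofReal_mul (abs_nonneg _), volDensity_transition g (hsp hy.2)]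

theorem chartVolume_compl_source (g : Metric m M) (p : M) :
    chartVolume g p (extChartAt (𝓡∂ m) p).sourceᶜ = 0 := by
  rw [chartVolume_apply g p (isOpen_extChartAt_source p).measurableSet.compl]
  have : (extChartAt (𝓡∂ m) p).target ∩ param p ⁻¹' (extChartAt (𝓡∂ m) p).sourceᶜ = ∅ := by
    ext y
    simp only [mem_inter_iff, mem_preimage, mem_compl_iff, mem_empty_iff_false, iff_false, not_and,
      not_not]
    exact fun hy => param_mem_source hy
  rw [this]
  simp

/-- On the domain of a chart, the Riemannian volume is given by the density of that chart. -/
theorem vol_restrict_source (g : Metric m M) (p : M) :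
    (vol g).restrict (extChartAt (𝓡∂ m) p).source = chartVolume g p := by
  set O := (extChartAt (𝓡∂ m) p).source
  have hO : MeasurableSet O := (isOpen_extChartAt_source p).measurableSet
  have hle : ∀ q, chartVolume g q ≤ vol g := fun q => le_iSup (chartVolume g) q
  -- The right-hand side is an upper bound of all chart volumes: on the chart domain they are
  -- compared with that of `p`, off the chart domain with `vol g` itself.
  have hupper : vol g ≤ chartVolume g p + (vol g).restrict Oᶜ := by
    refine iSup_le fun q => Measure.le_iff.2 fun s hs => ?_
    rw [← measure_inter_add_sdiff s hO, Measure.add_apply, Measure.restrict_apply hs]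
    exact add_le_add ((chartVolume_le_of_subset_source g p q (hs.inter hO)
      inter_subset_right).trans (measure_mono inter_subset_left)) (hle q _)
  refine le_antisymm (Measure.le_iff.2 fun s hs => ?_) (Measure.le_iff.2 fun s hs => ?_)
  · rw [Measure.restrict_apply hs]
    refine (hupper _).trans ?_
    rw [Measure.add_apply, Measure.restrict_apply (hs.inter hO), inter_assoc, inter_compl_self,
      inter_empty, measure_empty, add_zero]
    exact measure_mono inter_subset_left
  · rw [Measure.restrict_apply hs, ← measure_inter_add_sdiff s hO,
      measure_mono_null (show s \ O ⊆ Oᶜ from fun x hx => hx.2) (chartVolume_compl_source g p),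
      add_zero]
    exact hle p _

/-- The volume of a chart domain, as the image of a measure under a measurable embedding. -/
theorem chartVolume_eq_map (g : Metric m M) (p : M) :
    chartVolume g p = (Measure.comap Subtype.val
      ((volume.restrict (extChartAt (𝓡∂ m) p).target).withDensity
        fun y => ENNReal.ofReal (volDensity g p y))).map
      fun y : (extChartAt (𝓡∂ m) p).target => param p (y : Coord m) := by
  have ht := measurableSet_extChartAt_target (m := m) p
  ext s hs
  rw [chartVolume_apply g p hs, (measurableEmbedding_param p).map_apply,
    (MeasurableEmbedding.subtype_coe ht).comap_apply, withDensity_apply',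
    Measure.restrict_restrict' ht]
  congr 2
  ext y
  simp [and_comm]

/-- Integrals over the domain of a chart in terms of the coordinates. -/
theorem setIntegral_vol_source (g : Metric m M) (p : M) (G : M → ℝ) :
    ∫ x in (extChartAt (𝓡∂ m) p).source, G x ∂(vol g)
      = ∫ y in (extChartAt (𝓡∂ m) p).target, volDensity g p y * G (param p y) := by
  have ht := measurableSet_extChartAt_target (m := m) p
  rw [vol_restrict_source, chartVolume_eq_map, (measurableEmbedding_param p).integral_map,
    ← (MeasurableEmbedding.subtype_coe ht).integral_map (fun y => G (param p y)),
    map_comap_withDensity_target, integral_withDensity_eq_integral_toReal_smul₀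
      (aemeasurable_volDensity g p) (Eventually.of_forall fun _ => ENNReal.ofReal_lt_top)]
  simp_rw [ENNReal.toReal_ofReal (volDensity_nonneg g p _), smul_eq_mul]

theorem integrableOn_vol_source (g : Metric m M) (p : M) (G : M → ℝ) :
    IntegrableOn G (extChartAt (𝓡∂ m) p).source (vol g) ↔
      IntegrableOn (fun y => volDensity g p y * G (param p y)) (extChartAt (𝓡∂ m) p).target := by
  have ht := measurableSet_extChartAt_target (m := m) p
  rw [IntegrableOn, vol_restrict_source, chartVolume_eq_map,
    (measurableEmbedding_param p).integrable_map_iff,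
    show (G ∘ fun y : (extChartAt (𝓡∂ m) p).target => param p (y : Coord m))
      = (fun y => G (param p y)) ∘ Subtype.val from rfl,
    ← (MeasurableEmbedding.subtype_coe ht).integrable_map_iff,
    map_comap_withDensity_target, integrable_withDensity_iff_integrable_smul₀'
      (aemeasurable_volDensity g p) (Eventually.of_forall fun _ => ENNReal.ofReal_lt_top)]
  simp_rw [ENNReal.toReal_ofReal (volDensity_nonneg g p _), smul_eq_mul]
  rfl

end Volume

/-! ### Vector fields and test functions in a chart -/

section TestFunctions

variable {m : ℕ} [NeZero m] {M : Type*} [TopologicalSpace M]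
  [ChartedSpace (EuclideanHalfSpace m) M]

theorem dirDeriv_of_notMem_tsupport (V : (x : M) → TangentSpace (𝓡∂ m) x) {φ : M → ℝ} {x : M}
    (hx : x ∉ tsupport φ) : dirDeriv V φ x = 0 := by
  have h : φ =ᶠ[𝓝 x] fun _ => (0 : ℝ) := notMem_tsupport_iff_eventuallyEq.1 hx
  unfold dirDeriv
  rw [h.mfderiv_eq, mfderiv_const]
  rfl

theorem dirDeriv_smul (a : M → ℝ) (V : (x : M) → TangentSpace (𝓡∂ m) x) (φ : M → ℝ) (x : M) :
    dirDeriv (fun x => a x • V x) φ x = a x * dirDeriv V φ x := by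
  unfold dirDeriv
  exact map_smul _ _ _

/-- The coordinates `X^i` of the vector field `V = ∑ i, X^i • ∂/∂y_i` in the chart at `p`. -/
noncomputable def coordField (V : (x : M) → TangentSpace (𝓡∂ m) x) (p : M) (y : Coord m) :
    Coord m :=
  mfderiv (𝓡∂ m) 𝓘(ℝ, Coord m) (extChartAt (𝓡∂ m) p) (param p y) (V (param p y))

/-- The function on `M` supported in the domain of the chart at `p` which is given there by the
function `η` of the coordinates. -/
noncomputable def chartExtend (p : M) (η : Coord m → ℝ) : M → ℝ :=
  (extChartAt (𝓡∂ m) p).source.indicator fun x => η (extChartAt (𝓡∂ m) p x)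

/-- The function `φ`, supported in the domain of the chart at `p`, in terms of the coordinates. -/
noncomputable def chartPullback (p : M) (φ : M → ℝ) : Coord m → ℝ :=
  (extChartAt (𝓡∂ m) p '' tsupport φ).indicator fun y => φ (param p y)

theorem chartPullback_extChartAt {p : M} {φ : M → ℝ}
    (hφ : tsupport φ ⊆ (extChartAt (𝓡∂ m) p).source)
    {x : M} (hx : x ∈ (extChartAt (𝓡∂ m) p).source) :
    chartPullback p φ (extChartAt (𝓡∂ m) p x) = φ x := by
  unfold chartPullback
  by_cases h : x ∈ tsupport φ
  · rw [indicator_of_mem (mem_image_of_mem _ h), param_extChartAt hx]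
  · rw [indicator_of_notMem, image_eq_zero_of_notMem_tsupport h]
    rintro ⟨z, hz, hzx⟩
    exact h ((extChartAt (𝓡∂ m) p).injOn (hφ hz) hx hzx ▸ hz)

theorem isCompact_image_tsupport {p : M} {φ : M → ℝ} (hφc : HasCompactSupport φ)
    (hφ : tsupport φ ⊆ (extChartAt (𝓡∂ m) p).source) :
    IsCompact (extChartAt (𝓡∂ m) p '' tsupport φ) :=
  hφc.isCompact.image_of_continuousOn ((continuousOn_extChartAt p).mono hφ)

theorem tsupport_chartPullback {p : M} {φ : M → ℝ} (hφc : HasCompactSupport φ)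
    (hφ : tsupport φ ⊆ (extChartAt (𝓡∂ m) p).source) :
    tsupport (chartPullback p φ) ⊆ extChartAt (𝓡∂ m) p '' tsupport φ :=
  closure_minimal support_indicator_subset (isCompact_image_tsupport (m := m) hφc hφ).isClosed

theorem chartExtend_extChartAt {p : M} (η : Coord m → ℝ) {x : M}
    (hx : x ∈ (extChartAt (𝓡∂ m) p).source) :
    chartExtend p η x = η (extChartAt (𝓡∂ m) p x) := indicator_of_mem hx _

theorem tsupport_chartExtend [T2Space M] {p : M} {η : Coord m → ℝ} (hηc : HasCompactSupport η)
    (hη : tsupport η ⊆ (extChartAt (𝓡∂ m) p).target) :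
    tsupport (chartExtend p η) ⊆ param p '' tsupport η := by
  refine closure_minimal (fun x hx => ?_)
    (hηc.isCompact.image_of_continuousOn ((continuousOn_param p).mono hη)).isClosed
  have hxs : x ∈ (extChartAt (𝓡∂ m) p).source := by
    by_contra h
    exact hx (indicator_of_notMem h _)
  refine ⟨extChartAt (𝓡∂ m) p x, subset_tsupport _ ?_, param_extChartAt hxs⟩
  rw [Function.mem_support, chartExtend_extChartAt η hxs] at hx
  exact hx

theorem hasCompactSupport_chartExtend [T2Space M] {p : M} {η : Coord m → ℝ}
    (hηc : HasCompactSupport η) (hη : tsupport η ⊆ (extChartAt (𝓡∂ m) p).target) :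
    HasCompactSupport (chartExtend p η) :=
  (hηc.isCompact.image_of_continuousOn ((continuousOn_param p).mono hη)).of_isClosed_subset
    (isClosed_tsupport _) (tsupport_chartExtend hηc hη)

variable [IsManifold (𝓡∂ m) ∞ M]

theorem contDiff_chartPullback {p : M} {φ : M → ℝ} (hφs : ContMDiff (𝓡∂ m) 𝓘(ℝ, ℝ) ∞ φ)
    (hφc : HasCompactSupport φ) (hφ : tsupport φ ⊆ (extChartAt (𝓡∂ m) p).source)
    (hint : extChartAt (𝓡∂ m) p '' tsupport φ ⊆ interior (extChartAt (𝓡∂ m) p).target) :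
    ContDiff ℝ ∞ (chartPullback (m := m) p φ) := by
  refine contDiff_iff_contDiffAt.2 fun y => ?_
  by_cases hy : y ∈ extChartAt (𝓡∂ m) p '' tsupport φ
  · have hnhds : (extChartAt (𝓡∂ m) p).target ∈ 𝓝 y := mem_interior_iff_mem_nhds.1 (hint hy)
    have h1 : ContMDiffAt 𝓘(ℝ, Coord m) 𝓘(ℝ, ℝ) ∞ (fun y => φ (param p y)) y :=
      hφs.contMDiffAt.comp y ((contMDiffOn_extChartAt_symm p).contMDiffAt hnhds)
    refine h1.contDiffAt.congr_of_eventuallyEq ?_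
    filter_upwards [hnhds] with z hz
    conv_lhs => rw [← extChartAt_param hz]
    exact chartPullback_extChartAt hφ (param_mem_source hz)
  · have h0 : chartPullback p φ =ᶠ[𝓝 y] fun _ => (0 : ℝ) :=
      notMem_tsupport_iff_eventuallyEq.1 fun h => hy (tsupport_chartPullback hφc hφ h)
    exact contDiffAt_const.congr_of_eventuallyEq h0

theorem contMDiff_chartExtend [T2Space M] {p : M} {η : Coord m → ℝ} (hηs : ContDiff ℝ ∞ η)
    (hηc : HasCompactSupport η) (hη : tsupport η ⊆ (extChartAt (𝓡∂ m) p).target) :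
    ContMDiff (𝓡∂ m) 𝓘(ℝ, ℝ) ∞ (chartExtend p η) := by
  refine contMDiff_of_tsupport fun x hx => ?_
  obtain ⟨y, hy, rfl⟩ := tsupport_chartExtend hηc hη hx
  have hs : param p y ∈ (extChartAt (𝓡∂ m) p).source := param_mem_source (hη hy)
  have h1 : ContMDiffAt (𝓡∂ m) 𝓘(ℝ, ℝ) ∞ (fun x => η (extChartAt (𝓡∂ m) p x)) (param p y) :=
    hηs.contMDiff.contMDiffAt.comp _ (contMDiffAt_extChartAt' (by rwa [← extChartAt_source (𝓡∂ m)]))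
  refine h1.congr_of_eventuallyEq ?_
  filter_upwards [(isOpen_extChartAt_source p).mem_nhds hs] with z hz
    using chartExtend_extChartAt η hz

theorem dirDeriv_param (V : (x : M) → TangentSpace (𝓡∂ m) x) {p : M} {φ : M → ℝ} {η : Coord m → ℝ}
    (hη : Differentiable ℝ η)
    (hφη : ∀ x ∈ (extChartAt (𝓡∂ m) p).source, φ x = η (extChartAt (𝓡∂ m) p x))
    {y : Coord m} (hy : y ∈ (extChartAt (𝓡∂ m) p).target) :
    dirDeriv V φ (param p y) = ∑ i, coordField V p y i * fderiv ℝ η y (EuclideanSpace.single i 1) := by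
  have : IsManifold (𝓡∂ m) 1 M := isManifold_one
  have hs : param p y ∈ (extChartAt (𝓡∂ m) p).source := param_mem_source hy
  have hc : param p y ∈ (chartAt (EuclideanHalfSpace m) p).source := by
    rwa [← extChartAt_source (𝓡∂ m)]
  have hev : φ =ᶠ[𝓝 (param p y)] η ∘ extChartAt (𝓡∂ m) p := by
    filter_upwards [(isOpen_extChartAt_source p).mem_nhds hs] with z hz using hφη z hz
  have hd : MDifferentiableAt 𝓘(ℝ, Coord m) 𝓘(ℝ, ℝ) η (extChartAt (𝓡∂ m) p (param p y)) :=
    (hη _).mdifferentiableAt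
  have h1 : dirDeriv V φ (param p y) = fderiv ℝ η y (coordField V p y) := by
    unfold dirDeriv
    rw [hev.mfderiv_eq, mfderiv_comp _ hd (mdifferentiableAt_extChartAt hc), mfderiv_eq_fderiv,
      extChartAt_param hy]
    rfl
  have h2 : coordField V p y = ∑ i, coordField V p y i • EuclideanSpace.single i (1 : ℝ) := by
    have := (EuclideanSpace.basisFun (Fin m) ℝ).sum_repr (coordField V p y)
    simpa using this.symm
  rw [h1]
  conv_lhs => rw [h2]
  simp_rw [map_sum, map_smul, smul_eq_mul]

/-- The covariant components of a vector field in terms of its coordinates. -/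
theorem component_eq_sum (g : Metric m M) (V : (x : M) → TangentSpace (𝓡∂ m) x) {p : M}
    {y : Coord m} (hy : y ∈ (extChartAt (𝓡∂ m) p).target) (j : Fin m) :
    component g V p (EuclideanSpace.single j 1) y
      = ∑ i, coordField V p y i * gramMatrix g p y i j := by
  unfold component
  have h := coordVector_mfderiv_extChartAt hy (V (param p y))
  conv_lhs => rw [← h]
  have h2 := inner_coordVector g p y (coordField V p y) (EuclideanSpace.single j 1)
  refine h2.trans (Finset.sum_congr rfl fun i _ => ?_)
  rw [Finset.sum_eq_single j]
  · simp
  · intro k _ hk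
    simp [hk]
  · simp

/-- The coordinates of a vector field in terms of its covariant components. -/
theorem coordField_eq_sum (g : Metric m M) (V : (x : M) → TangentSpace (𝓡∂ m) x) {p : M}
    {y : Coord m} (hy : y ∈ (extChartAt (𝓡∂ m) p).target) (i : Fin m) :
    coordField V p y i
      = ∑ j, (gramMatrix g p y)⁻¹ j i * component g V p (EuclideanSpace.single j 1) y := by
  have hdet : IsUnit (gramMatrix g p y).det := (det_gramMatrix_pos g hy).ne'.isUnit
  have h : (fun j => component g V p (EuclideanSpace.single j 1) y)
      = Matrix.vecMul (coordField V p y).ofLp (gramMatrix g p y) := by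
    ext j
    rw [component_eq_sum g V hy]
    rfl
  have h2 : (coordField V p y).ofLp = Matrix.vecMul
      (fun j => component g V p (EuclideanSpace.single j 1) y) (gramMatrix g p y)⁻¹ := by
    rw [h, Matrix.vecMul_vecMul, Matrix.mul_nonsing_inv _ hdet, Matrix.vecMul_one]
  rw [h2]
  simp only [Matrix.vecMul, dotProduct]
  exact Finset.sum_congr rfl fun j _ => mul_comm _ _

theorem sum_coordField_mul_component_nonneg (g : Metric m M) (V : (x : M) → TangentSpace (𝓡∂ m) x)
    {p : M} {y : Coord m} (hy : y ∈ (extChartAt (𝓡∂ m) p).target) :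
    0 ≤ ∑ i, coordField V p y i * component g V p (EuclideanSpace.single i 1) y := by
  have h := inner_coordVector g p y (coordField V p y) (coordField V p y)
  have h1 : ∑ i, coordField V p y i * component g V p (EuclideanSpace.single i 1) y
      = g.inner (param p y) (coordVector p y (coordField V p y))
        (coordVector p y (coordField V p y)) := by
    rw [h, Finset.sum_comm]
    refine Finset.sum_congr rfl fun j _ => ?_
    rw [component_eq_sum g V hy, Finset.mul_sum]
    refine Finset.sum_congr rfl fun i _ => by ring
  rw [h1]
  rcases eq_or_ne (coordVector p y (coordField V p y)) 0 with h0 | h0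
  · rw [h0, map_zero]
  · exact (g.pos _ _ h0).le

end TestFunctions

/-! ### The weak inequality in a chart -/

section Local

variable {m : ℕ} [NeZero m] {M : Type*} [TopologicalSpace M]
  [ChartedSpace (EuclideanHalfSpace m) M]

theorem dirDeriv_sum {ι : Type*} (s : Finset ι) (V : (x : M) → TangentSpace (𝓡∂ m) x)
    {φ : ι → M → ℝ} {x : M} (hφ : ∀ i ∈ s, MDifferentiableAt (𝓡∂ m) 𝓘(ℝ, ℝ) (φ i) x) :
    dirDeriv V (∑ i ∈ s, φ i) x = ∑ i ∈ s, dirDeriv V (φ i) x := by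
  classical
  suffices h : MDifferentiableAt (𝓡∂ m) 𝓘(ℝ, ℝ) (∑ i ∈ s, φ i) x ∧
      dirDeriv V (∑ i ∈ s, φ i) x = ∑ i ∈ s, dirDeriv V (φ i) x from h.2
  induction s using Finset.induction_on with
  | empty =>
    rw [Finset.sum_empty, Finset.sum_empty]
    exact ⟨mdifferentiableAt_const, dirDeriv_of_notMem_tsupport V (by simp [tsupport])⟩
  | insert i s hi IH =>
    obtain ⟨h2, h3⟩ := IH fun j hj => hφ j (Finset.mem_insert_of_mem hj)
    have h1 := (hφ i (Finset.mem_insert_self i s)).hasMFDerivAt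
    rw [Finset.sum_insert hi, Finset.sum_insert hi, ← h3]
    refine ⟨(h1.add h2.hasMFDerivAt).mdifferentiableAt, ?_⟩
    unfold dirDeriv
    rw [(h1.add h2.hasMFDerivAt).mfderiv]
    rfl

variable [IsManifold (𝓡∂ m) ∞ M]

/-- On an open set of coordinates, the weak gradient on the manifold has the weak partial
derivatives as components. -/
theorem IsWeakGradient.hasWeakDerivOn {g : Metric m M} {D : Set M} {u : M → ℝ}
    {V : (x : M) → TangentSpace (𝓡∂ m) x} (hV : IsWeakGradient g D u V) {p : M}
    {O : Set (Coord m)} (hO : IsOpen O) (hOD : O ⊆ chartDomain p D) :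
    HasWeakDerivOn volume O (fun y => u (param p y)) (fun e y => component g V p e y) where
  memLp e K hK hKO := hV.memLp_grad p e K hK (hKO.trans hOD)
  integral_eq e ψ hψ hψc hψO := hV.integral_eq p e ψ hψ hψc
    (hψO.trans (interior_maximal hOD hO))

theorem memLp_volDensity_mul_coordField {g : Metric m M} {D : Set M} {u : M → ℝ}
    {V : (x : M) → TangentSpace (𝓡∂ m) x} (hV : IsWeakGradient g D u V) {p : M}
    (i : Fin m) {K : Set (Coord m)} (hK : IsCompact K) (hKD : K ⊆ chartDomain p D) :
    MemLp (fun y => volDensity g p y * coordField V p y i) 2 (volume.restrict K) := by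
  have hKt : K ⊆ (extChartAt (𝓡∂ m) p).target := fun y hy => (hKD hy).1
  have h : MemLp (fun y => ∑ j, (volDensity g p y * (gramMatrix g p y)⁻¹ j i)
      * component g V p (EuclideanSpace.single j 1) y) 2 (volume.restrict K) :=
    memLp_finsetSum _ fun j _ => memLp_restrict_continuousOn_mul (hV.memLp_grad p _ K hK hKD)
      (((continuousOn_volDensity g p).mul (continuousOn_inv_gramMatrix g p j i)).mono hKt) hK
  refine h.ae_eq ?_
  filter_upwards [ae_restrict_mem hK.measurableSet] with y hy
  rw [coordField_eq_sum g V (hKt hy), Finset.mul_sum]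
  exact Finset.sum_congr rfl fun j _ => by ring

variable [MeasurableSpace M] [BorelSpace M]

/-- The pairing of a vector field `a • V` with the gradient of a function supported in the domain
of a chart, in coordinates. -/
theorem integral_mul_dirDeriv (g : Metric m M) (V : (x : M) → TangentSpace (𝓡∂ m) x) (a : M → ℝ)
    {p : M} {φ : M → ℝ} {η : Coord m → ℝ} (hη : Differentiable ℝ η)
    (hφη : ∀ x ∈ (extChartAt (𝓡∂ m) p).source, φ x = η (extChartAt (𝓡∂ m) p x))
    (hφ : tsupport φ ⊆ (extChartAt (𝓡∂ m) p).source)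
    (hηt : tsupport η ⊆ (extChartAt (𝓡∂ m) p).target) :
    ∫ x, a x * dirDeriv V φ x ∂(vol g) = ∫ y, a (param p y) *
      ∑ i, (volDensity g p y * coordField V p y i) * fderiv ℝ η y (EuclideanSpace.single i 1) := by
  rw [← setIntegral_eq_integral_of_forall_compl_eq_zero (s := (extChartAt (𝓡∂ m) p).source)
    (fun x hx => by rw [dirDeriv_of_notMem_tsupport V fun h => hx (hφ h), mul_zero]),
    setIntegral_vol_source]
  refine Eq.trans ?_ (setIntegral_eq_integral_of_forall_compl_eq_zero
    (s := (extChartAt (𝓡∂ m) p).target) fun y hy => by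
      rw [fderiv_of_notMem_tsupport (𝕜 := ℝ) fun h => hy (hηt h)]; simp)
  refine setIntegral_congr_fun (measurableSet_extChartAt_target p) fun y hy => ?_
  simp only
  rw [dirDeriv_param V hη hφη hy, Finset.mul_sum, Finset.mul_sum, Finset.mul_sum]
  exact Finset.sum_congr rfl fun i _ => by ring

theorem integrable_mul_dirDeriv {g : Metric m M} {D : Set M} {u : M → ℝ}
    {V : (x : M) → TangentSpace (𝓡∂ m) x} (hV : IsWeakGradient g D u V) {a : M → ℝ}
    (ha : Continuous a) {p : M} {φ : M → ℝ} {η : Coord m → ℝ} (hη : ContDiff ℝ ∞ η)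
    (hηc : HasCompactSupport η)
    (hφη : ∀ x ∈ (extChartAt (𝓡∂ m) p).source, φ x = η (extChartAt (𝓡∂ m) p x))
    (hφ : tsupport φ ⊆ (extChartAt (𝓡∂ m) p).source) (hηt : tsupport η ⊆ chartDomain p D) :
    Integrable (fun x => a x * dirDeriv V φ x) (vol g) := by
  have hts : tsupport η ⊆ (extChartAt (𝓡∂ m) p).target := fun y hy => (hηt hy).1
  have hK : IsCompact (tsupport η) := hηc
  have ht := measurableSet_extChartAt_target (m := m) p
  rw [← integrableOn_iff_integrable_of_support_subset (s := (extChartAt (𝓡∂ m) p).source),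
    integrableOn_vol_source]
  · have h1 : IntegrableOn (fun y => a (param p y) * ∑ i,
        (volDensity g p y * coordField V p y i) * fderiv ℝ η y (EuclideanSpace.single i 1))
        (tsupport η) := by
      refine memLp_one_iff_integrable.1 (memLp_restrict_continuousOn_mul
        (memLp_one_iff_integrable.2 (integrable_finsetSum _ fun i _ => ?_))
        (ha.comp_continuousOn ((continuousOn_param p).mono hts)) hK)
      exact (memLp_volDensity_mul_coordField hV i hK hηt).integrable_mul
        (memLp_restrict_of_continuousOn ((hη.continuous_fderiv (by simp)).clm_apply
          continuous_const).continuousOn hK 2)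
    have h2 : IntegrableOn (fun y => a (param p y) * ∑ i,
        (volDensity g p y * coordField V p y i) * fderiv ℝ η y (EuclideanSpace.single i 1))
        (extChartAt (𝓡∂ m) p).target := by
      refine h1.of_forall_sdiff_eq_zero ht fun y hy => ?_
      rw [fderiv_of_notMem_tsupport (𝕜 := ℝ) hy.2]; simp
    refine h2.congr_fun (fun y hy => ?_) ht
    simp only
    rw [dirDeriv_param V (hη.differentiable (by simp)) hφη hy, Finset.mul_sum, Finset.mul_sum,
      Finset.mul_sum]
    exact Finset.sum_congr rfl fun i _ => by ring
  · intro x hx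
    by_contra h
    exact hx (mul_eq_zero_of_right _ (dirDeriv_of_notMem_tsupport V fun h' => h (hφ h')))

/-- If `V = ∇u` with `Δu ≥ 0` in the weak sense on `D`, then `-∫ ⟨h(u) ∇u, ∇φ⟩ ≥ 0` for every
non-negative increasing `h` and every test function `φ ≥ 0` supported in a coordinate patch
contained in `D` and in the interior of the chart. -/
theorem integral_comp_mul_dirDeriv_nonpos [T2Space M] {g : Metric m M} {D : Set M} {u : M → ℝ}
    {V : (x : M) → TangentSpace (𝓡∂ m) x} (hu : Continuous u) (hV : IsWeakGradient g D u V)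
    (hsub : ∀ φ : M → ℝ, ContMDiff (𝓡∂ m) 𝓘(ℝ, ℝ) ∞ φ → HasCompactSupport φ → tsupport φ ⊆ D →
      (∀ x, 0 ≤ φ x) → 0 ≤ - ∫ x in D, dirDeriv V φ x ∂(vol g))
    {p : M} {O : Set (Coord m)} (hO : IsOpen O) (hOD : O ⊆ chartDomain p D)
    {h : ℝ → ℝ} (hh : ContDiff ℝ ∞ h) (hh0 : ∀ t, 0 ≤ h t) (hmono : Monotone h)
    {φ : M → ℝ} (hφs : ContMDiff (𝓡∂ m) 𝓘(ℝ, ℝ) ∞ φ) (hφc : HasCompactSupport φ)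
    (hφ0 : ∀ x, 0 ≤ φ x) (hφ : tsupport φ ⊆ (extChartAt (𝓡∂ m) p).source)
    (hφO : extChartAt (𝓡∂ m) p '' tsupport φ ⊆ O) :
    Integrable (fun x => h (u x) * dirDeriv V φ x) (vol g) ∧
      ∫ x, h (u x) * dirDeriv V φ x ∂(vol g) ≤ 0 := by
  have hOt : O ⊆ (extChartAt (𝓡∂ m) p).target := fun y hy => (hOD hy).1
  set η := chartPullback (m := m) p φ with hη
  have hηs : ContDiff ℝ ∞ η :=
    contDiff_chartPullback hφs hφc hφ (hφO.trans (interior_maximal hOt hO))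
  have hηts : tsupport η ⊆ O := (tsupport_chartPullback hφc hφ).trans hφO
  have hηc : HasCompactSupport η := HasCompactSupport.of_support_subset_isCompact
    (isCompact_image_tsupport hφc hφ)
    ((subset_tsupport η).trans (tsupport_chartPullback hφc hφ))
  have hφη : ∀ x ∈ (extChartAt (𝓡∂ m) p).source, φ x = η (extChartAt (𝓡∂ m) p x) :=
    fun x hx => (chartPullback_extChartAt hφ hx).symm
  have hη0 : ∀ y, 0 ≤ η y := fun y => indicator_nonneg (fun _ _ => hφ0 _) y
  refine ⟨integrable_mul_dirDeriv hV (hh.continuous.comp hu) hηs hηc hφη hφ (hηts.trans hOD), ?_⟩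
  rw [integral_mul_dirDeriv g V (fun x => h (u x)) (hηs.differentiable (by simp)) hφη hφ
    (hηts.trans hOt)]
  refine (hV.hasWeakDerivOn hO hOD).integral_comp_mul_nonpos hO
    (hu.comp_continuousOn ((continuousOn_param p).mono hOt))
    (F := fun i y => volDensity g p y * coordField V p y i)
    (fun i K hK hKO => memLp_volDensity_mul_coordField hV i hK (hKO.trans hOD))
    (fun y hy => ?_) (fun ζ hζs hζc hζO hζ0 => ?_) hh hh0 hmono hηs hηc hηts hη0
  · simp_rw [mul_assoc, ← Finset.mul_sum]
    exact mul_nonneg (volDensity_nonneg g p y)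
      (sum_coordField_mul_component_nonneg g V (hOt hy))
  · have hζt := hζO.trans hOt
    have hsupp := tsupport_chartExtend (p := p) hζc hζt
    have hsource : tsupport (chartExtend p ζ) ⊆ (extChartAt (𝓡∂ m) p).source := by
      refine hsupp.trans ?_
      rintro _ ⟨y, hy, rfl⟩
      exact param_mem_source (hζt hy)
    have hD : tsupport (chartExtend p ζ) ⊆ D := by
      refine hsupp.trans ?_
      rintro _ ⟨y, hy, rfl⟩
      exact (hOD (hζO hy)).2
    have h1 := hsub (chartExtend p ζ) (contMDiff_chartExtend hζs hζc hζt)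
      (hasCompactSupport_chartExtend hζc hζt) hD (fun x => indicator_nonneg (fun _ _ => hζ0 _) x)
    rw [setIntegral_eq_integral_of_forall_compl_eq_zero (fun x hx =>
      dirDeriv_of_notMem_tsupport V fun h => hx (hD h))] at h1
    have h2 := integral_mul_dirDeriv g V (fun _ => 1) (hζs.differentiable (by simp))
      (fun x hx => chartExtend_extChartAt ζ hx) hsource hζt
    simp only [one_mul] at h2
    rw [← h2]
    linarith

end Local

/-! ### Convex functions of a subsolution -/

theorem exists_contDiff_cutoff {E : Type*} [NormedAddCommGroup E] [NormedSpace ℝ E]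
    [FiniteDimensional ℝ E] {K O : Set E} (hK : IsCompact K) (hO : IsOpen O) (hKO : K ⊆ O) :
    ∃ χ : E → ℝ, ContDiff ℝ ∞ χ ∧ HasCompactSupport χ ∧ tsupport χ ⊆ O ∧ ∀ y ∈ K, χ y = 1 := by
  obtain ⟨L, hL, hKL, hLO⟩ := exists_compact_between hK hO hKO
  obtain ⟨χ, h0, h1, -⟩ := exists_contMDiffMap_zero_one_of_isClosed (n := (⊤ : ℕ∞)) 𝓘(ℝ, E)
    (isOpen_interior (s := L)).isClosed_compl hK.isClosed
    (disjoint_left.2 fun y hy hyK => hy (hKL hyK))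
  have hsupp : Function.support χ ⊆ L := fun y hy => by
    by_contra h
    exact hy (h0 fun hyL => h (interior_subset hyL))
  exact ⟨χ, χ.contMDiff.contDiff, HasCompactSupport.of_support_subset_isCompact hL hsupp,
    (closure_minimal hsupp hL.isClosed).trans hLO, fun y hy => h1 hy⟩

section Truncation

variable {m : ℕ} [NeZero m] {M : Type*} [TopologicalSpace M]
  [ChartedSpace (EuclideanHalfSpace m) M] [IsManifold (𝓡∂ m) ∞ M]

/-- If `f` vanishes below the level `c`, and `u` is larger than some `c' < c` only inside `D`,
then `f(u)` is in `W^{1,2}_loc(M)` as soon as `u` is in `W^{1,2}_loc(D)`. -/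
theorem IsWeakGradient.comp_univ {g : Metric m M} {D : Set M} {u : M → ℝ}
    {V : (x : M) → TangentSpace (𝓡∂ m) x} (hu : Continuous u) (hV : IsWeakGradient g D u V)
    {c c' : ℝ} (hcc : c' < c) (hD : ∀ x, c' < u x → x ∈ D) {f h : ℝ → ℝ}
    (hf : ∀ t, HasDerivAt f (h t) t) (hh : Continuous h) (hfc : ∀ t ≤ c, f t = 0)
    (hhc : ∀ t ≤ c, h t = 0) :
    IsWeakGradient g univ (fun x => f (u x)) (fun x => h (u x) • V x) := by
  have hfcont : Continuous f := continuous_iff_continuousAt.2 fun t => (hf t).continuousAt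
  have htarget : ∀ p : M, chartDomain (m := m) p univ = (extChartAt (𝓡∂ m) p).target := fun p => by
    simp [chartDomain]
  have huc : ∀ (p : M) (K : Set (Coord m)), K ⊆ chartDomain p univ →
      ContinuousOn (fun y => u (param p y)) K := fun p K hK =>
    hu.comp_continuousOn ((continuousOn_param p).mono fun y hy => (hK hy).1)
  have hcomp : ∀ (p : M) (e y : Coord m), component g (fun x => h (u x) • V x) p e y
      = h (u (param p y)) * component g V p e y := fun p e y => by
    unfold component
    rw [map_smul]
    rfl
  -- The part of a compact set of coordinates where `u ≥ c` represents points of `D` only.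
  have hpart : ∀ (p : M) (K : Set (Coord m)), IsCompact K → K ⊆ chartDomain p univ →
      IsCompact (K ∩ {y | c ≤ u (param p y)}) := fun p K hK hKD =>
    hK.of_isClosed_subset ((huc p K hKD).preimage_isClosed_of_isClosed hK.isClosed isClosed_Ici)
      inter_subset_left
  refine ⟨fun p K hK hKD => ?_, fun p e K hK hKD => ?_, fun p e ψ hψ hψc hψD => ?_⟩
  · exact memLp_restrict_of_continuousOn (hfcont.comp_continuousOn (huc p K hKD)) hK 2
  · set K' := K ∩ {y | c ≤ u (param p y)}
    have hK' : IsCompact K' := hpart p K hK hKD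
    have hK'D : K' ⊆ chartDomain p D := fun y hy => ⟨(hKD hy.1).1, hD _ (hcc.trans_le hy.2)⟩
    have h1 : MemLp (fun y => h (u (param p y)) * component g V p e y) 2 (volume.restrict K') :=
      memLp_restrict_continuousOn_mul (hV.memLp_grad p e K' hK' hK'D)
        (hh.comp_continuousOn (huc p K' (inter_subset_left.trans hKD))) hK'
    have h2 : MemLp (K'.indicator fun y => h (u (param p y)) * component g V p e y) 2
        (volume.restrict K) := by
      rw [memLp_indicator_iff_restrict hK'.measurableSet,
        Measure.restrict_restrict hK'.measurableSet, inter_eq_left.2 inter_subset_left]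
      exact h1
    refine h2.ae_eq ?_
    filter_upwards [ae_restrict_mem hK.measurableSet] with y hy
    rw [hcomp]
    by_cases hyc : c ≤ u (param p y)
    · rw [indicator_of_mem (show y ∈ K' from ⟨hy, hyc⟩)]
    · rw [indicator_of_notMem fun h' => hyc h'.2, hhc _ (not_le.1 hyc).le, zero_mul]
  · rw [htarget] at hψD
    set O := interior (extChartAt (𝓡∂ m) p).target ∩ (fun y => u (param p y)) ⁻¹' Ioi c'
    have huint : ContinuousOn (fun y => u (param p y)) (interior (extChartAt (𝓡∂ m) p).target) :=
      huc p _ (by rw [htarget]; exact interior_subset)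
    have hO : IsOpen O := huint.isOpen_inter_preimage isOpen_interior isOpen_Ioi
    have hOD : O ⊆ chartDomain p D := fun y hy => ⟨interior_subset hy.1, hD _ hy.2⟩
    have hψt : tsupport ψ ⊆ chartDomain p univ := by
      rw [htarget]; exact hψD.trans interior_subset
    have hKO : tsupport ψ ∩ {y | c ≤ u (param p y)} ⊆ O := fun y hy =>
      ⟨hψD hy.1, hcc.trans_le hy.2⟩
    obtain ⟨χ, hχ, hχc, hχO, hχ1⟩ := exists_contDiff_cutoff (hpart p _ hψc hψt) hO hKO
    have hchain := (hV.hasWeakDerivOn hO hOD).comp hO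
      (huint.mono inter_subset_left) hf hh
    have hkey := hchain.integral_eq e (fun y => χ y * ψ y) (hχ.mul hψ) hχc.mul_right
      ((tsupport_mul_subset_left).trans hχO)
    -- Where `u > c`, the cutoff is invisible.
    have hloc : ∀ y, c < u (param p y) → y ∈ tsupport ψ →
        (fun y => χ y * ψ y) =ᶠ[𝓝 y] ψ := by
      intro y hy hyψ
      have hev : ∀ᶠ z in 𝓝 y, c < u (param p z) :=
        (huint.continuousAt (isOpen_interior.mem_nhds (hψD hyψ))).eventually (lt_mem_nhds hy)
      filter_upwards [hev] with z hz
      by_cases hzψ : z ∈ tsupport ψ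
      · rw [hχ1 z ⟨hzψ, hz.le⟩, one_mul]
      · rw [image_eq_zero_of_notMem_tsupport hzψ, mul_zero]
    have h1 : ∀ y, f (u (param p y)) * fderiv ℝ (fun y => χ y * ψ y) y e
        = f (u (param p y)) * fderiv ℝ ψ y e := by
      intro y
      rcases le_or_gt (u (param p y)) c with hy | hy
      · rw [hfc _ hy, zero_mul, zero_mul]
      · by_cases hyψ : y ∈ tsupport ψ
        · rw [(hloc y hy hyψ).fderiv_eq]
        · rw [fderiv_of_notMem_tsupport (𝕜 := ℝ) hyψ,
            fderiv_of_notMem_tsupport (𝕜 := ℝ) fun h' => hyψ (tsupport_mul_subset_right h')]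
    have h2 : ∀ y, h (u (param p y)) * component g V p e y * (χ y * ψ y)
        = component g (fun x => h (u x) • V x) p e y * ψ y := by
      intro y
      rw [hcomp]
      rcases le_or_gt (u (param p y)) c with hy | hy
      · rw [hhc _ hy]; simp
      · by_cases hyψ : y ∈ tsupport ψ
        · rw [hχ1 y ⟨hyψ, hy.le⟩, one_mul]
        · rw [image_eq_zero_of_notMem_tsupport hyψ]; simp
    simpa only [h1, h2] using hkey

variable [T2Space M] [SecondCountableTopology M] [MeasurableSpace M] [BorelSpace M]

/-- If `Δu ≥ 0` in the weak sense in the interior of `M`, and `h ≥ 0` is increasing and vanishes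
below a level which `u` exceeds only inside the interior, then the weak Neumann inequality holds on
all of `M` for the field `h(u) ∇u`. -/
theorem integral_dirDeriv_comp_smul_nonpos {g : Metric m M} {u : M → ℝ}
    {V : (x : M) → TangentSpace (𝓡∂ m) x} (hu : Continuous u)
    (hV : IsWeakGradient g ((𝓡∂ m).interior M) u V)
    (hsub : ∀ φ : M → ℝ, ContMDiff (𝓡∂ m) 𝓘(ℝ, ℝ) ∞ φ → HasCompactSupport φ →
      tsupport φ ⊆ (𝓡∂ m).interior M → (∀ x, 0 ≤ φ x) →
      0 ≤ - ∫ x in (𝓡∂ m).interior M, dirDeriv V φ x ∂(vol g))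
    {c c' : ℝ} (hcc : c' < c) (hD : ∀ x, c' < u x → x ∈ (𝓡∂ m).interior M)
    {h : ℝ → ℝ} (hh : ContDiff ℝ ∞ h) (hh0 : ∀ t, 0 ≤ h t) (hmono : Monotone h)
    (hhc : ∀ t ≤ c, h t = 0)
    {φ : M → ℝ} (hφs : ContMDiff (𝓡∂ m) 𝓘(ℝ, ℝ) ∞ φ) (hφc : HasCompactSupport φ)
    (hφ0 : ∀ x, 0 ≤ φ x) :
    ∫ x, dirDeriv (fun x => h (u x) • V x) φ x ∂(vol g) ≤ 0 := by
  have : LocallyCompactSpace (EuclideanHalfSpace m) := (𝓡∂ m).locallyCompactSpace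
  have : LocallyCompactSpace M := ChartedSpace.locallyCompactSpace (EuclideanHalfSpace m) M
  set K := tsupport φ ∩ {x | c ≤ u x}
  have hK : IsCompact K := hφc.isCompact.inter_right (isClosed_le continuous_const hu)
  let O : M → Set (Coord m) := fun p =>
    interior (extChartAt (𝓡∂ m) p).target ∩ (fun y => u (param p y)) ⁻¹' Ioi c'
  have hO : ∀ p, IsOpen (O p) := fun p =>
    (hu.comp_continuousOn ((continuousOn_param p).mono
      interior_subset)).isOpen_inter_preimage isOpen_interior isOpen_Ioi
  have hOD : ∀ p, O p ⊆ chartDomain p ((𝓡∂ m).interior M) := fun p y hy =>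
    ⟨interior_subset hy.1, hD _ hy.2⟩
  let U : M → Set M := fun p => (extChartAt (𝓡∂ m) p).source ∩ extChartAt (𝓡∂ m) p ⁻¹' O p
  have hU : ∀ p, IsOpen (U p) := fun p =>
    (continuousOn_extChartAt p).isOpen_inter_preimage (isOpen_extChartAt_source p) (hO p)
  have hmemU : ∀ x ∈ K, x ∈ U x := fun x hx => by
    have hxs := mem_extChartAt_source (I := 𝓡∂ m) x
    have hxu : c' < u x := hcc.trans_le hx.2
    refine ⟨hxs, ModelWithCorners.isInteriorPoint_iff.1 (hD x hxu), ?_⟩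
    simp only [mem_preimage, mem_Ioi]
    rwa [param_extChartAt hxs]
  obtain ⟨t, ht, hKt⟩ := hK.elim_nhds_subcover U fun x hx => (hU x).mem_nhds (hmemU x hx)
  obtain ⟨ρ, hρ⟩ := SmoothPartitionOfUnity.exists_isSubordinate (𝓡∂ m) hK.isClosed
    (fun i : t => U i) (fun i => hU i) (fun x hx => by
      obtain ⟨i, hi, hxi⟩ := mem_iUnion₂.1 (hKt hx)
      exact mem_iUnion.2 ⟨⟨i, hi⟩, hxi⟩)
  let φ' : t → M → ℝ := fun i x => ρ i x * φ x
  have hφ's : ∀ i, ContMDiff (𝓡∂ m) 𝓘(ℝ, ℝ) ∞ (φ' i) := fun i => (ρ i).contMDiff.mul hφs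
  have hφ'U : ∀ i, tsupport (φ' i) ⊆ U i := fun i => tsupport_mul_subset_left.trans (hρ i)
  have hpiece : ∀ i, Integrable (fun x => h (u x) * dirDeriv V (φ' i) x) (vol g) ∧
      ∫ x, h (u x) * dirDeriv V (φ' i) x ∂(vol g) ≤ 0 := fun i =>
    integral_comp_mul_dirDeriv_nonpos hu hV hsub (hO i) (hOD i) hh hh0 hmono (hφ's i)
      hφc.mul_left (fun x => mul_nonneg (ρ.nonneg i x) (hφ0 x)) (fun x hx => (hφ'U i hx).1)
      (by rintro _ ⟨x, hx, rfl⟩; exact (hφ'U i hx).2)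
  have hsum : ∀ x, dirDeriv (fun x => h (u x) • V x) φ x
      = ∑ i, h (u x) * dirDeriv V (φ' i) x := by
    intro x
    rw [dirDeriv_smul (fun x => h (u x)), ← Finset.mul_sum]
    rcases le_or_gt (u x) c with hx | hx
    · rw [hhc _ hx, zero_mul, zero_mul]
    · rw [← dirDeriv_sum _ V fun i _ => (hφ's i).mdifferentiableAt (by simp)]
      have hev : φ =ᶠ[𝓝 x] ∑ i, φ' i := by
        filter_upwards [(isOpen_lt continuous_const hu).mem_nhds hx] with z hz
        rw [Finset.sum_apply, ← Finset.sum_mul]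
        by_cases hzφ : z ∈ tsupport φ
        · have h1 := ρ.sum_eq_one (x := z) ⟨hzφ, le_of_lt hz⟩
          rw [finsum_eq_sum_of_fintype] at h1
          rw [h1, one_mul]
        · rw [image_eq_zero_of_notMem_tsupport hzφ, mul_zero]
      unfold dirDeriv
      rw [hev.mfderiv_eq]
      rfl
  simp_rw [hsum]
  rw [integral_finsetSum _ fun i _ => (hpiece i).1]
  exact Finset.sum_nonpos fun i _ => (hpiece i).2

end Truncation

/-- The primitive, vanishing below `c`, of the smooth function `expNegInvGlue (t - c)`. It is
convex, and strictly positive above `c`. -/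
noncomputable def convexGlue (c t : ℝ) : ℝ := ∫ s in c..t, expNegInvGlue (s - c)

theorem continuous_expNegInvGlue_sub (c : ℝ) : Continuous fun s => expNegInvGlue (s - c) :=
  (expNegInvGlue.contDiff (n := 0)).continuous.comp (continuous_id.sub continuous_const)

theorem hasDerivAt_convexGlue (c t : ℝ) :
    HasDerivAt (convexGlue c) (expNegInvGlue (t - c)) t :=
  intervalIntegral.integral_hasDerivAt_right
    ((continuous_expNegInvGlue_sub c).intervalIntegrable _ _)
    ((continuous_expNegInvGlue_sub c).stronglyMeasurableAtFilter _ _)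
    (continuous_expNegInvGlue_sub c).continuousAt

theorem convexGlue_of_le {c t : ℝ} (h : t ≤ c) : convexGlue c t = 0 := by
  unfold convexGlue
  rw [intervalIntegral.integral_congr (g := fun _ => 0), intervalIntegral.integral_zero]
  intro s hs
  rw [uIcc_of_ge h] at hs
  exact expNegInvGlue.zero_of_nonpos (sub_nonpos.2 hs.2)

theorem convexGlue_pos {c t : ℝ} (h : c < t) : 0 < convexGlue c t :=
  intervalIntegral.intervalIntegral_pos_of_pos_on
    ((continuous_expNegInvGlue_sub c).intervalIntegrable _ _)
    (fun _ hs => expNegInvGlue.pos_of_pos (sub_pos.2 hs.1)) h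

theorem monotone_convexGlue (c : ℝ) : Monotone (convexGlue c) :=
  monotone_of_hasDerivAt_nonneg (hasDerivAt_convexGlue c) fun _ => expNegInvGlue.nonneg _

end RiemBdry

theorem mainTheorem8 (m : ℕ) [NeZero m] (M : Type*) [TopologicalSpace M] [T2Space M]
    [SecondCountableTopology M] [ChartedSpace (EuclideanHalfSpace m) M]
    [IsManifold (𝓡∂ m) ∞ M] [MeasurableSpace M] [BorelSpace M]
    (g : RiemBdry.Metric m M) (hbd : ((𝓡∂ m).boundary M).Nonempty)
    (hM : RiemBdry.IsParabolic g)
    (u : M → ℝ) (hu : Continuous u)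
    (hW : RiemBdry.MemW12loc g ((𝓡∂ m).interior M) u)
    (hsub : RiemBdry.IsWeakNeumannSubsolution g ((𝓡∂ m).interior M) u)
    (hbdd : BddAbove (Set.range u)) :
    sSup (Set.range u) = sSup (u '' (𝓡∂ m).boundary M) := by
  have hbdd' : BddAbove (u '' (𝓡∂ m).boundary M) := hbdd.mono (image_subset_range _ _)
  refine le_antisymm ?_ (csSup_le_csSup hbdd (hbd.image u) (image_subset_range _ _))
  by_contra! hlt
  obtain ⟨x₀, hx₀⟩ := hbd
  obtain ⟨_, ⟨x₁, rfl⟩, hx₁⟩ := exists_lt_of_lt_csSup ⟨u x₀, mem_range_self x₀⟩ hlt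
  obtain ⟨c, hc, hcx₁⟩ := exists_between hx₁
  have hbdry : ∀ x ∈ (𝓡∂ m).boundary M, u x ≤ sSup (u '' (𝓡∂ m).boundary M) :=
    fun x hx => le_csSup hbdd' (mem_image_of_mem u hx)
  have hD : ∀ x, sSup (u '' (𝓡∂ m).boundary M) < u x → x ∈ (𝓡∂ m).interior M := by
    intro x hx
    rw [← ModelWithCorners.compl_boundary]
    exact fun hxb => (hbdry x hxb).not_gt hx
  obtain ⟨V, hV, hVsub⟩ := hsub
  have hhs : ContDiff ℝ ∞ fun t : ℝ => expNegInvGlue (t - c) :=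
    expNegInvGlue.contDiff.comp (contDiff_id.sub contDiff_const)
  have hhc : ∀ t ≤ c, expNegInvGlue (t - c) = 0 := fun t ht =>
    expNegInvGlue.zero_of_nonpos (sub_nonpos.2 ht)
  have hgrad := hV.comp_univ hu hc hD (RiemBdry.hasDerivAt_convexGlue c) hhs.continuous
    (fun t ht => RiemBdry.convexGlue_of_le ht) hhc
  have hcont : Continuous fun x => RiemBdry.convexGlue c (u x) :=
    (continuous_iff_continuousAt.2 fun t =>
      (RiemBdry.hasDerivAt_convexGlue c t).continuousAt).comp hu
  obtain ⟨k, hk⟩ := hM (fun x => RiemBdry.convexGlue c (u x)) hcont ⟨_, hgrad⟩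
    ⟨_, hgrad, fun φ hφs hφc _ hφ0 => by
      rw [Measure.restrict_univ]
      exact neg_nonneg.2 (RiemBdry.integral_dirDeriv_comp_smul_nonpos hu hV hVsub hc hD hhs
        (fun t => expNegInvGlue.nonneg _)
        (fun a b hab => expNegInvGlue.monotone (sub_le_sub_right hab c)) hhc hφs hφc hφ0)⟩
    (by
      obtain ⟨B, hB⟩ := hbdd
      refine ⟨RiemBdry.convexGlue c B, ?_⟩
      rintro _ ⟨x, rfl⟩
      exact RiemBdry.monotone_convexGlue c (hB (mem_range_self x)))
  have h0 : RiemBdry.convexGlue c (u x₀) = 0 :=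
    RiemBdry.convexGlue_of_le ((hbdry x₀ hx₀).trans hc.le)
  have h1 : 0 < RiemBdry.convexGlue c (u x₁) := RiemBdry.convexGlue_pos hcx₁
  rw [hk x₁, ← hk x₀, h0] at h1
  exact lt_irrefl _ h1
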